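/- Let $\mathbb H$ be the quaternions, $\mathbb D=\{q\in\mathbb H:|q|<1\}$, $\mathbb S$ the set of $j\in\mathbb H$ with $\operatorname{Re} j=0$ and $|j|=1$, and for $j\in\mathbb S$ let $\mathbb C_j=\{x_0+jx_1:x_0,x_1\in\mathbb R\}$ and $\mathbb D_j=\mathbb D\cap\mathbb C_j$. Fix a real number $\alpha>-1$ and $i\in\mathbb S$, and let $dA_{\alpha,i}(z)=\frac{\alpha+1}{\pi}(1-|z|^2)^\alpha\,dm_i(z)$ on $\mathbb D_i$, where $m_i$ is Lebesgue measure on $\mathbb C_i$. A real differentiable function $f:\mathbb D\to\mathbb H$ is called left slice hyperholomorphic if $f(x_0+jx_1)=a(x_0,x_1)+j\,b(x_0,x_1)$ for all $j\in\mathbb S$ and all $x_0+jx_1\in\mathbb D$, with $\mathbb H$-valued differentiable functions $a,b$ satisfying $a(x_0,-x_1)=a(x_0,x_1)$, $b(x_0,-x_1)=-b(x_0,x_1)$, $\partial_{x_0}a=\partial_{x_1}b$ and $\partial_{x_0}b=-\partial_{x_1}a$. Let $\mathcal A=\mathcal A^2_{\alpha,i}(\mathbb D)$ be the right quaternionic Hilbert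 space of all left slice hyperholomorphic $f:\mathbb D\to\mathbb H$ with $\int_{\mathbb D_i}|f|^2\,dA_{\alpha,i}<\infty$, with scalar product $\langle f,g\rangle=\int_{\mathbb D_i}\overline{f(z)}\,g(z)\,dA_{\alpha,i}(z)$ and norm $\|f\|=\langle f,f\rangle^{1/2}$. For $w\in\mathbb D$ let $K_w\in\mathcal A$ be the reproducing kernel, i.e. the unique element with $\langle K_w,f\rangle=f(w)$ for all $f\in\mathcal A$, and let $k_w=K_w/\sqrt{K_w(w)}$. Let $J$ be the operator on $\mathcal A$ that sends $f$ to the unique left slice hyperholomorphic function on $\mathbb D$ whose restriction to $\mathbb D_i$ is $z\mapsto i f(z)$, and let $\mathcal B_J(\mathcal A)$ be the set of bounded right $\mathbb H$-linear operators $T$ on $\mathcal A$ with $TJ=JT$; put $\|T\|=\sup_{\|f\|=1}\|Tf\|$. The Berezin transform of $T\in\mathcal B_J(\mathcal A)$ is $\widetilde T(z)=\langle k_z,Tk_z\rangle$, $z\in\mathbb D_i$. For $z,w\in\mathbb D_i$ let $$\rho(z,w)=\frac{|z-w|}{|1-z\overline w|},\qquad \beta(z,w)=\frac12\log\frac{1+\rho(z,w)}{1-\rho(z,w)}$$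 be the pseudo-hyperbolic and the Bergman metric. **Theorem.** For every $T\in\mathcal B_J(\mathcal A^2_{\alpha,i}(\mathbb D))$, $$|\widetilde T(z)-\widetilde T(w)|\le 2\sqrt{2+\alpha}\,\|T\|\,\beta(z,w)\qquad\text{for all } z,w\in\mathbb D_i.$$ Furthermore the constant is sharp: if $C\in\mathbb R$ is such that $|\widetilde T(z)-\widetilde T(w)|\le C\,\|T\|\,\beta(z,w)$ for all $T\in\mathcal B_J(\mathcal A^2_{\alpha,i}(\mathbb D))$ and all $z,w\in\mathbb D_i$, then $C\ge 2\sqrt{2+\alpha}$. -/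

import Mathlib

open scoped Quaternion
open MeasureTheory MulOpposite

namespace SliceBergman

/-- The sphere `𝕊` of imaginary units of the quaternions. -/
def ImagUnit : Type := {i : ℍ[ℝ] // i.re = 0 ∧ ‖i‖ = 1}

/-- The open unit ball `𝔻` of the quaternions. -/
def unitBall : Set ℍ[ℝ] := Metric.ball 0 1

/-- The point `x₀ + i x₁` of the quaternions. -/
noncomputable def pt (i : ℍ[ℝ]) (x₀ x₁ : ℝ) : ℍ[ℝ] := (x₀ : ℍ[ℝ]) + i * (x₁ : ℍ[ℝ])

/-- The complex plane `ℂ_i = {x₀ + i x₁}`. -/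
def slicePlane (i : ImagUnit) : Set ℍ[ℝ] := {q | ∃ x₀ x₁ : ℝ, q = pt i.1 x₀ x₁}

/-- The slice disc `𝔻_i = 𝔻 ∩ ℂ_i`. -/
def sliceDisc (i : ImagUnit) : Set ℍ[ℝ] := unitBall ∩ slicePlane i

/-- Left slice hyperholomorphic functions on an axially symmetric open set `U`: real differentiable
functions of the form `f (x₀ + i x₁) = a (x₀, x₁) + i b (x₀, x₁)` for every imaginary unit `i`, where
`a` is even and `b` is odd in `x₁` and `a`, `b` satisfy the Cauchy-Riemann system. -/
def IsLeftSliceHyperholomorphicOn (f : ℍ[ℝ] → ℍ[ℝ]) (U : Set ℍ[ℝ]) : Prop :=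
  DifferentiableOn ℝ f U ∧
  ∃ a b : ℝ × ℝ → ℍ[ℝ], ∀ (i : ImagUnit) (x₀ x₁ : ℝ), pt i.1 x₀ x₁ ∈ U →
    f (pt i.1 x₀ x₁) = a (x₀, x₁) + i.1 * b (x₀, x₁) ∧
    a (x₀, -x₁) = a (x₀, x₁) ∧ b (x₀, -x₁) = -b (x₀, x₁) ∧
    DifferentiableAt ℝ a (x₀, x₁) ∧ DifferentiableAt ℝ b (x₀, x₁) ∧
    fderiv ℝ a (x₀, x₁) (1, 0) = fderiv ℝ b (x₀, x₁) (0, 1) ∧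
    fderiv ℝ b (x₀, x₁) (1, 0) = -fderiv ℝ a (x₀, x₁) (0, 1)

/-- The measure `((α + 1) / π) (1 - |z|²) ^ α dm(z)` on the unit disc of `ℂ`. Integrals over `𝔻_i` with
respect to `dA_{α,i}` are integrals against this measure after the isometric identification
`z ↦ z.re + i z.im` of `ℂ` with `ℂ_i`. -/
noncomputable def discMeasure (α : ℝ) : Measure ℂ :=
  (volume.restrict (Metric.ball (0 : ℂ) 1)).withDensity
    fun z => ENNReal.ofReal ((α + 1) / Real.pi * (1 - ‖z‖ ^ 2) ^ α)

/-- The restriction `f_i` of `f` to `ℂ_i`, read as a function on `ℂ`. -/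
noncomputable def restr (i : ImagUnit) (f : ℍ[ℝ] → ℍ[ℝ]) (z : ℂ) : ℍ[ℝ] := f (pt i.1 z.re z.im)

theorem norm_pt_sq (i : ImagUnit) (x y : ℝ) : ‖pt i.1 x y‖ ^ 2 = x ^ 2 + y ^ 2 := by
  obtain ⟨i, h0, h1⟩ := i
  have h2 : Quaternion.normSq i = 1 := by rw [Quaternion.normSq_eq_norm_mul_self, h1]; norm_num
  rw [Quaternion.normSq_def'] at h2
  rw [sq, ← Quaternion.normSq_eq_norm_mul_self, Quaternion.normSq_def']
  simp only [pt, Quaternion.re_add, Quaternion.imI_add, Quaternion.imJ_add, Quaternion.imK_add,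
    Quaternion.re_mul, Quaternion.imI_mul, Quaternion.imJ_mul, Quaternion.imK_mul,
    Quaternion.re_coe, Quaternion.imI_coe, Quaternion.imJ_coe, Quaternion.imK_coe]
  rw [h0] at h2 ⊢
  linear_combination y ^ 2 * h2

theorem pt_mem_unitBall (i : ImagUnit) (x y : ℝ) : pt i.1 x y ∈ unitBall ↔ x ^ 2 + y ^ 2 < 1 := by
  rw [unitBall, mem_ball_zero_iff, ← norm_pt_sq i x y, sq_lt_one_iff₀ (norm_nonneg _)]

theorem IsLeftSliceHyperholomorphicOn.add {f g : ℍ[ℝ] → ℍ[ℝ]} {U : Set ℍ[ℝ]}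
    (hf : IsLeftSliceHyperholomorphicOn f U) (hg : IsLeftSliceHyperholomorphicOn g U) :
    IsLeftSliceHyperholomorphicOn (f + g) U := by
  obtain ⟨hf, a, b, hab⟩ := hf
  obtain ⟨hg, a', b', hab'⟩ := hg
  refine ⟨hf.add hg, a + a', b + b', fun i x y h => ?_⟩
  obtain ⟨h1, h2, h3, h4, h5, h6, h7⟩ := hab i x y h
  obtain ⟨k1, k2, k3, k4, k5, k6, k7⟩ := hab' i x y h
  refine ⟨?_, ?_, ?_, h4.add k4, h5.add k5, ?_, ?_⟩
  · simp only [Pi.add_apply, h1, k1, mul_add]; abel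
  · simp only [Pi.add_apply, h2, k2]
  · simp only [Pi.add_apply, h3, k3]; abel
  · rw [fderiv_add h4 k4, fderiv_add h5 k5]
    simp only [_root_.add_apply, h6, k6]
  · rw [fderiv_add h4 k4, fderiv_add h5 k5]
    simp only [_root_.add_apply, h7, k7]; abel

theorem IsLeftSliceHyperholomorphicOn.mul_const {f : ℍ[ℝ] → ℍ[ℝ]} {U : Set ℍ[ℝ]}
    (hf : IsLeftSliceHyperholomorphicOn f U) (c : ℍ[ℝ]) :
    IsLeftSliceHyperholomorphicOn (fun x => f x * c) U := by
  obtain ⟨hf, a, b, hab⟩ := hf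
  refine ⟨hf.mul_const c, fun p => a p * c, fun p => b p * c, fun i x y h => ?_⟩
  obtain ⟨h1, h2, h3, h4, h5, h6, h7⟩ := hab i x y h
  refine ⟨?_, ?_, ?_, h4.mul_const c, h5.mul_const c, ?_, ?_⟩
  · simp only [h1, add_mul, mul_assoc]
  · simp only [h2]
  · simp only [h3, neg_mul]
  · rw [fderiv_mul_const' h4, fderiv_mul_const' h5]
    simp [h6]
  · rw [fderiv_mul_const' h4, fderiv_mul_const' h5]
    simp [h7]

/-- The weighted slice Bergman space `𝒜²_{α,i}(𝔻)` as a right quaternionic vector space. A function on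
`𝔻` is represented by its extension by zero to the quaternions. -/
noncomputable def bergmanSpace (α : ℝ) (i : ImagUnit) : Submodule (ℍ[ℝ])ᵐᵒᵖ (ℍ[ℝ] → ℍ[ℝ]) where
  carrier := {f | (∀ x, x ∉ unitBall → f x = 0) ∧ IsLeftSliceHyperholomorphicOn f unitBall ∧
    MemLp (restr i f) 2 (discMeasure α)}
  add_mem' := by
    rintro f g ⟨hf, hf', hf''⟩ ⟨hg, hg', hg''⟩
    exact ⟨fun x hx => by simp [hf x hx, hg x hx], hf'.add hg', hf''.add hg''⟩
  zero_mem' := by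
    refine ⟨fun _ _ => rfl, ⟨differentiableOn_const 0, 0, 0, fun i x y _ => ?_⟩, MemLp.zero⟩
    have h0 : DifferentiableAt ℝ (0 : ℝ × ℝ → ℍ[ℝ]) (x, y) := differentiableAt_const 0
    refine ⟨by simp, by simp, by simp, h0, h0, by simp, by simp⟩
  smul_mem' := by
    rintro c f ⟨hf, hf', hf''⟩
    exact ⟨fun x hx => by simp [hf x hx], hf'.mul_const c.unop, hf''.const_smul c⟩

/-- The scalar product `⟨f, g⟩ = ∫_{𝔻_i} conj (f z) g z dA_{α,i}(z)`. -/
noncomputable def bInner {α : ℝ} {i : ImagUnit} (f g : bergmanSpace α i) : ℍ[ℝ] :=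
  ∫ z, star (restr i f z) * restr i g z ∂(discMeasure α)

/-- The norm `‖f‖ = (∫_{𝔻_i} |f z|² dA_{α,i}(z))^{1/2}`. -/
noncomputable def bNorm {α : ℝ} {i : ImagUnit} (f : bergmanSpace α i) : ℝ :=
  √(∫ z, ‖restr i f z‖ ^ 2 ∂(discMeasure α))

/-- The unit `i_x = Im x / |Im x|` (with value `0` at real `x`, where the choice of `i_x` never
matters). -/
noncomputable def unitOf (x : ℍ[ℝ]) : ℍ[ℝ] := x.im * ((‖x.im‖⁻¹ : ℝ) : ℍ[ℝ])

open scoped Classical in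
/-- The left slice hyperholomorphic extension to `𝔻` of a function given on `𝔻_i`, through the
representation formula
`ext g (x) = (1/2) (1 - i_x i) g (x₀ + i x₁) + (1/2) (1 + i_x i) g (x₀ - i x₁)`, `x = x₀ + i_x x₁`. -/
noncomputable def extL (i : ImagUnit) (g : ℍ[ℝ] → ℍ[ℝ]) (x : ℍ[ℝ]) : ℍ[ℝ] :=
  if x ∈ unitBall then
    ((1 / 2 : ℝ) : ℍ[ℝ]) * (1 - unitOf x * i.1) * g (pt i.1 x.re ‖x.im‖) +
      ((1 / 2 : ℝ) : ℍ[ℝ]) * (1 + unitOf x * i.1) * g (pt i.1 x.re (-‖x.im‖))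
  else 0


theorem eq_zero_of_eq_neg {x : ℍ[ℝ]} (h : x = -x) : x = 0 := by
  have h2 : (2 : ℝ) • x = 0 := by
    rw [two_smul]
    nth_rewrite 1 [h]
    exact neg_add_cancel x
  exact (smul_eq_zero.mp h2).resolve_left two_ne_zero

theorem continuous_reIm : Continuous fun x : ℍ[ℝ] => (x.re, ‖x.im‖) :=
  Quaternion.continuous_re.prodMk Quaternion.continuous_im.norm

theorem normSq_eq_re_im (x : ℍ[ℝ]) : ‖x‖ ^ 2 = x.re ^ 2 + ‖x.im‖ ^ 2 := by
  rw [sq, sq ‖x.im‖, ← Quaternion.normSq_eq_norm_mul_self, ← Quaternion.normSq_eq_norm_mul_self,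
    Quaternion.normSq_def', Quaternion.normSq_def']
  simp; ring

theorem abs_re_le_norm (x : ℍ[ℝ]) : |x.re| ≤ ‖x‖ := by
  refine abs_le_of_sq_le_sq ?_ (norm_nonneg _)
  nlinarith [normSq_eq_re_im x, sq_nonneg ‖x.im‖]

theorem norm_im_le_norm (x : ℍ[ℝ]) : ‖x.im‖ ≤ ‖x‖ := by
  refine (sq_le_sq₀ (norm_nonneg _) (norm_nonneg _)).mp ?_
  nlinarith [normSq_eq_re_im x, sq_nonneg x.re]

theorem norm_unitOf_le (x : ℍ[ℝ]) : ‖unitOf x‖ ≤ 1 := by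
  rw [unitOf, norm_mul, Quaternion.norm_coe, norm_inv, norm_norm]
  exact mul_inv_le_one

theorem unitOf_mul_norm (x : ℍ[ℝ]) : unitOf x * ((‖x.im‖ : ℝ) : ℍ[ℝ]) = x.im := by
  rw [unitOf, mul_assoc, ← Quaternion.coe_mul]
  rcases eq_or_ne x.im 0 with h | h
  · simp [h]
  · rw [inv_mul_cancel₀ (norm_ne_zero_iff.mpr h)]; simp

/-- The real part as a continuous real linear map. -/
noncomputable def reL : ℍ[ℝ] →L[ℝ] ℝ :=
  LinearMap.toContinuousLinearMap
    { toFun := fun x => x.re, map_add' := fun _ _ => rfl, map_smul' := fun _ _ => rfl }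

/-- The vector part as a continuous real linear map. -/
noncomputable def imL : ℍ[ℝ] →L[ℝ] ℍ[ℝ] :=
  LinearMap.toContinuousLinearMap
    { toFun := fun x => x.im, map_add' := fun _ _ => by simp, map_smul' := fun _ _ => by simp }

theorem differentiableAt_stem {a b : ℝ × ℝ → ℍ[ℝ]}
    (H : ∀ x y : ℝ, x ^ 2 + y ^ 2 < 1 → a (x, -y) = a (x, y) ∧ b (x, -y) = -b (x, y) ∧
      DifferentiableAt ℝ a (x, y) ∧ DifferentiableAt ℝ b (x, y))
    {q : ℍ[ℝ]} (hq : q ∈ unitBall) :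
    DifferentiableAt ℝ (fun x : ℍ[ℝ] => a (x.re, ‖x.im‖) + unitOf x * b (x.re, ‖x.im‖)) q := by
  have hq1 : q.re ^ 2 + ‖q.im‖ ^ 2 < 1 := by
    rw [← normSq_eq_re_im, sq_lt_one_iff₀ (norm_nonneg _)]
    exact mem_ball_zero_iff.mp hq
  obtain ⟨-, -, ha, hb⟩ := H _ _ hq1
  have hre : DifferentiableAt ℝ (fun x : ℍ[ℝ] => x.re) q := reL.differentiableAt
  have him : DifferentiableAt ℝ (fun x : ℍ[ℝ] => x.im) q := imL.differentiableAt
  rcases eq_or_ne q.im 0 with h0 | h0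
  · rw [h0, norm_zero] at ha hb hq1
    have hop : ∀ᶠ t : ℝ in nhds 0, (q.re + t) ^ 2 + 0 ^ 2 < 1 :=
      (continuous_const.add continuous_id |>.pow 2 |>.add continuous_const).continuousAt.eventually_lt
        continuousAt_const (by simpa using hq1)
    have hop' : ∀ᶠ t : ℝ in nhds 0, q.re ^ 2 + t ^ 2 < 1 :=
      (continuous_const.add (continuous_id.pow 2)).continuousAt.eventually_lt
        continuousAt_const (by simpa using hq1)
    have hb0 : ∀ x : ℝ, x ^ 2 + 0 ^ 2 < 1 → b (x, 0) = 0 := by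
      intro x hx
      have := (H x 0 hx).2.1
      rw [neg_zero] at this
      exact eq_zero_of_eq_neg this
    have hA : fderiv ℝ a (q.re, 0) (0, 1) = 0 := by
      have l1 : HasDerivAt (fun t : ℝ => (q.re, t)) ((0 : ℝ), (1 : ℝ)) 0 :=
        (hasDerivAt_const _ _).prodMk (hasDerivAt_id _)
      have l2 : HasDerivAt (fun t : ℝ => (q.re, -t)) ((0 : ℝ), (-1 : ℝ)) 0 :=
        (hasDerivAt_const _ _).prodMk (hasDerivAt_id _).neg
      have d1 := HasFDerivAt.comp_hasDerivAt (0 : ℝ) (l := a) (f := fun t : ℝ => (q.re, t))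
        ha.hasFDerivAt l1
      have d2 := HasFDerivAt.comp_hasDerivAt (0 : ℝ) (l := a) (l' := fderiv ℝ a (q.re, 0))
        (f := fun t : ℝ => (q.re, -t)) (by simpa using ha.hasFDerivAt) l2
      have d3 := d2.congr_of_eventuallyEq (f₁ := a ∘ fun t : ℝ => (q.re, t)) (by
        filter_upwards [hop'] with t ht
        exact (H _ _ ht).1.symm)
      have e := d1.unique d3
      have e2 : ((0 : ℝ), (-1 : ℝ)) = -((0 : ℝ), (1 : ℝ)) := by simp
      rw [e2, map_neg] at e
      exact eq_zero_of_eq_neg e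
    have hB : fderiv ℝ b (q.re, 0) (1, 0) = 0 := by
      have l1 : HasDerivAt (fun t : ℝ => (q.re + t, (0 : ℝ))) ((1 : ℝ), (0 : ℝ)) 0 :=
        ((hasDerivAt_id _).const_add _).prodMk (hasDerivAt_const _ _)
      have d1 := HasFDerivAt.comp_hasDerivAt (0 : ℝ) (l := b) (l' := fderiv ℝ b (q.re, 0))
        (f := fun t : ℝ => (q.re + t, (0 : ℝ))) (by simpa using hb.hasFDerivAt) l1
      have d3 := (hasDerivAt_const (0 : ℝ) (0 : ℍ[ℝ])).congr_of_eventuallyEq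
        (f₁ := b ∘ fun t : ℝ => (q.re + t, (0 : ℝ))) (by
        filter_upwards [hop] with t ht
        exact hb0 _ ht)
      exact d1.unique d3
    have hT : Filter.Tendsto (fun x : ℍ[ℝ] => (x.re, ‖x.im‖)) (nhds q) (nhds (q.re, 0)) := by
      have := continuous_reIm.tendsto q
      rwa [h0, norm_zero] at this
    have hO : (fun x : ℍ[ℝ] => ((x.re, ‖x.im‖) : ℝ × ℝ) - (q.re, 0)) =O[nhds q]
        fun x => x - q := by
      refine Asymptotics.IsBigO.of_bound 1 (Filter.Eventually.of_forall fun x => ?_)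
      have k1 : |x.re - q.re| ≤ ‖x - q‖ := by simpa using abs_re_le_norm (x - q)
      have k2 : ‖x.im‖ ≤ ‖x - q‖ := by simpa [h0] using norm_im_le_norm (x - q)
      simp only [Prod.mk_sub_mk, sub_zero, one_mul, Prod.norm_mk, Real.norm_eq_abs, abs_norm]
      exact max_le k1 k2
    have oa := (ha.hasFDerivAt.isLittleO.comp_tendsto hT).trans_isBigO hO
    have ob := (hb.hasFDerivAt.isLittleO.comp_tendsto hT).trans_isBigO hO
    have hsplit : ∀ (L : ℝ × ℝ →L[ℝ] ℍ[ℝ]) (s t : ℝ), L (s, t) = s • L (1, 0) + t • L (0, 1) := by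
      intro L s t
      rw [← map_smul, ← map_smul, ← map_add]
      simp
    have da : DifferentiableAt ℝ (fun x : ℍ[ℝ] => a (x.re, ‖x.im‖)) q := by
      have : HasFDerivAt (fun x : ℍ[ℝ] => a (x.re, ‖x.im‖))
          (reL.smulRight (fderiv ℝ a (q.re, 0) (1, 0))) q := by
        rw [hasFDerivAt_iff_isLittleO]
        refine oa.congr_left fun x => ?_
        simp only [Function.comp, Prod.mk_sub_mk, sub_zero, hsplit _ (x.re - q.re), hA, smul_zero,
          add_zero, h0, norm_zero]
        simp only [ContinuousLinearMap.smulRight_apply, map_sub, ← sub_smul]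
        rfl
      exact this.differentiableAt
    have db : DifferentiableAt ℝ (fun x : ℍ[ℝ] => unitOf x * b (x.re, ‖x.im‖)) q := by
      have o2 : (fun x : ℍ[ℝ] => unitOf x * ((fun p => b p - b (q.re, 0) -
          fderiv ℝ b (q.re, 0) (p - (q.re, 0))) ∘ fun x : ℍ[ℝ] => (x.re, ‖x.im‖)) x)
          =o[nhds q] fun x => x - q := by
        refine Asymptotics.IsBigO.trans_isLittleO ?_ ob
        refine Asymptotics.IsBigO.of_bound 1 (Filter.Eventually.of_forall fun x => ?_)
        rw [norm_mul]
        exact mul_le_mul_of_nonneg_right (norm_unitOf_le x) (norm_nonneg _)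
      have : HasFDerivAt (fun x : ℍ[ℝ] => unitOf x * b (x.re, ‖x.im‖))
          (((ContinuousLinearMap.mul ℝ ℍ[ℝ]).flip (fderiv ℝ b (q.re, 0) (0, 1))).comp imL) q := by
        rw [hasFDerivAt_iff_isLittleO]
        refine o2.congr_left fun x => ?_
        simp only [Function.comp, Prod.mk_sub_mk, sub_zero, hsplit _ (x.re - q.re), hB, smul_zero,
          zero_add, h0, norm_zero, hb0 _ hq1, mul_zero, mul_sub]
        have e : unitOf x * ‖x.im‖ • fderiv ℝ b (q.re, 0) (0, 1) =
            x.im * fderiv ℝ b (q.re, 0) (0, 1) := by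
          rw [← Quaternion.coe_mul_eq_smul, ← mul_assoc, unitOf_mul_norm]
        rw [e]
        simp [imL, h0]
      exact this.differentiableAt
    exact da.add db
  · have hn : DifferentiableAt ℝ (fun x : ℍ[ℝ] => ‖x.im‖) q := him.norm ℝ h0
    have hφ : DifferentiableAt ℝ (fun x : ℍ[ℝ] => (x.re, ‖x.im‖)) q := hre.prodMk hn
    have hu : DifferentiableAt ℝ unitOf q := by
      have h1 : DifferentiableAt ℝ (fun x : ℍ[ℝ] => ‖x.im‖⁻¹ • x.im) q :=
        (hn.inv (norm_ne_zero_iff.mpr h0)).smul him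
      have h2 : unitOf = fun x : ℍ[ℝ] => ‖x.im‖⁻¹ • x.im := by
        funext x
        rw [unitOf, Quaternion.mul_coe_eq_smul]
      rwa [h2]
    exact (DifferentiableAt.comp q (g := a) ha hφ).add
      (hu.mul (DifferentiableAt.comp q (g := b) hb hφ))

theorem unit_mul_self (i : ImagUnit) : i.1 * i.1 = -1 := by
  obtain ⟨i, h0, h1⟩ := i
  have h2 : Quaternion.normSq i = 1 := by rw [Quaternion.normSq_eq_norm_mul_self, h1]; norm_num
  have h3 : star i = -i := Quaternion.star_eq_neg.mpr h0
  have h4 := Quaternion.self_mul_star i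
  rw [h3, h2, mul_neg] at h4
  simpa [neg_eq_iff_eq_neg] using h4

theorem pt_re (i : ImagUnit) (x y : ℝ) : (pt i.1 x y).re = x := by
  simp [pt, i.2.1]

theorem pt_im (i : ImagUnit) (x y : ℝ) : (pt i.1 x y).im = y • i.1 := by
  ext <;> simp [pt, i.2.1, mul_comm]

theorem norm_pt_im (i : ImagUnit) (x y : ℝ) : ‖(pt i.1 x y).im‖ = |y| := by
  rw [pt_im, norm_smul, i.2.2, mul_one, Real.norm_eq_abs]

theorem extL_apply (i : ImagUnit) {f : ℍ[ℝ] → ℍ[ℝ]} {a b : ℝ × ℝ → ℍ[ℝ]} {x : ℍ[ℝ]} (hx : x ∈ unitBall)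
    (H : ∀ (i : ImagUnit) (x₀ x₁ : ℝ), pt i.1 x₀ x₁ ∈ unitBall →
      f (pt i.1 x₀ x₁) = a (x₀, x₁) + i.1 * b (x₀, x₁) ∧
      a (x₀, -x₁) = a (x₀, x₁) ∧ b (x₀, -x₁) = -b (x₀, x₁)) :
    extL i (fun z => i.1 * f z) x =
      i.1 * a (x.re, ‖x.im‖) + unitOf x * (i.1 * b (x.re, ‖x.im‖)) := by
  have h1 : x.re ^ 2 + ‖x.im‖ ^ 2 < 1 := by
    rw [← normSq_eq_re_im, sq_lt_one_iff₀ (norm_nonneg _)]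
    exact mem_ball_zero_iff.mp hx
  obtain ⟨e1, e2, e3⟩ := H i x.re ‖x.im‖ ((pt_mem_unitBall _ _ _).mpr h1)
  obtain ⟨e4, -, -⟩ := H i x.re (-‖x.im‖) ((pt_mem_unitBall _ _ _).mpr (by simpa using h1))
  rw [extL, if_pos hx, e1, e4, e2, e3]
  generalize a (x.re, ‖x.im‖) = A
  generalize b (x.re, ‖x.im‖) = B
  generalize unitOf x = u
  have k1 : i.1 * (A + i.1 * B) = i.1 * A - B := by
    rw [mul_add, ← mul_assoc i.1 i.1 B, unit_mul_self]; simp [sub_eq_add_neg]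
  have k2 : i.1 * (A + i.1 * -B) = i.1 * A + B := by
    rw [mul_add, ← mul_assoc i.1 i.1 (-B), unit_mul_self]; simp
  rw [k1, k2, mul_assoc, mul_assoc, ← mul_add]
  have k3 : (1 - u * i.1) * (i.1 * A - B) + (1 + u * i.1) * (i.1 * A + B) =
      (2 : ℝ) • (i.1 * A + u * (i.1 * B)) := by
    rw [two_smul]; noncomm_ring
  rw [k3, Quaternion.coe_mul_eq_smul, smul_smul]
  norm_num

theorem extL_pt (i k : ImagUnit) {f : ℍ[ℝ] → ℍ[ℝ]} {a b : ℝ × ℝ → ℍ[ℝ]} {x y : ℝ} (hx : pt k.1 x y ∈ unitBall)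
    (H : ∀ (i : ImagUnit) (x₀ x₁ : ℝ), pt i.1 x₀ x₁ ∈ unitBall →
      f (pt i.1 x₀ x₁) = a (x₀, x₁) + i.1 * b (x₀, x₁) ∧
      a (x₀, -x₁) = a (x₀, x₁) ∧ b (x₀, -x₁) = -b (x₀, x₁)) :
    extL i (fun z => i.1 * f z) (pt k.1 x y) = i.1 * a (x, y) + k.1 * (i.1 * b (x, y)) := by
  obtain ⟨-, e2, e3⟩ := H k x y hx
  rw [extL_apply i hx H, unitOf, norm_pt_im, pt_re, pt_im]
  rcases lt_trichotomy y 0 with h | h | h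
  · have h1 : y • k.1 * ((|y|⁻¹ : ℝ) : ℍ[ℝ]) = -k.1 := by
      rw [Quaternion.mul_coe_eq_smul, smul_smul, abs_of_neg h]
      have : (-y)⁻¹ * y = -1 := by rw [inv_neg, neg_mul, inv_mul_cancel₀ h.ne]
      rw [this]; simp
    rw [h1, abs_of_neg h, e2, e3]; simp
  · subst h
    have hb : b (x, 0) = 0 := by
      rw [neg_zero] at e3
      exact eq_zero_of_eq_neg e3
    simp [hb]
  · have h1 : y • k.1 * ((|y|⁻¹ : ℝ) : ℍ[ℝ]) = k.1 := by
      rw [Quaternion.mul_coe_eq_smul, smul_smul, abs_of_pos h, inv_mul_cancel₀ h.ne', one_smul]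
    rw [h1, abs_of_pos h]

theorem extL_mem {α : ℝ} {i : ImagUnit} {f : ℍ[ℝ] → ℍ[ℝ]} (hf : f ∈ bergmanSpace α i) :
    extL i (fun z => i.1 * f z) ∈ bergmanSpace α i := by
  obtain ⟨hf0, ⟨-, a, b, hab⟩, hL⟩ := hf
  have H : ∀ (i : ImagUnit) (x₀ x₁ : ℝ), pt i.1 x₀ x₁ ∈ unitBall →
      f (pt i.1 x₀ x₁) = a (x₀, x₁) + i.1 * b (x₀, x₁) ∧
      a (x₀, -x₁) = a (x₀, x₁) ∧ b (x₀, -x₁) = -b (x₀, x₁) := fun i x y h =>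
    ⟨(hab i x y h).1, (hab i x y h).2.1, (hab i x y h).2.2.1⟩
  refine ⟨fun x hx => by rw [extL, if_neg hx], ⟨?_, fun p => i.1 * a p, fun p => i.1 * b p, ?_⟩, ?_⟩
  · intro q hq
    refine ((differentiableAt_stem (a := fun p => i.1 * a p) (b := fun p => i.1 * b p)
      (fun x y hxy => ?_) hq).congr_of_eventuallyEq ?_).differentiableWithinAt
    · obtain ⟨-, h2, h3, h4, h5, -, -⟩ := hab i x y ((pt_mem_unitBall _ _ _).mpr hxy)
      exact ⟨by simp [h2], by simp [h3], h4.const_mul _, h5.const_mul _⟩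
    · filter_upwards [Metric.isOpen_ball.mem_nhds hq] with x hx
      exact extL_apply i hx H
  · intro k x y h
    obtain ⟨-, h2, h3, h4, h5, h6, h7⟩ := hab k x y h
    refine ⟨extL_pt i k h H, by simp [h2], by simp [h3], h4.const_mul _, h5.const_mul _, ?_, ?_⟩
    · rw [fderiv_const_mul h4, fderiv_const_mul h5]; simp [h6]
    · rw [fderiv_const_mul h4, fderiv_const_mul h5]; simp [h7]
  · have e : restr i (extL i fun z => i.1 * f z) = fun z => i.1 * restr i f z := by
      funext z
      by_cases hz : pt i.1 z.re z.im ∈ unitBall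
      · rw [restr, extL_pt i i hz H, restr, (H i _ _ hz).1, mul_add]
      · rw [restr, extL, if_neg hz, restr, hf0 _ hz, mul_zero]
    rw [e]
    exact hL.const_mul i.1

/-- The operator `J f = ext (i f_i)`. -/
noncomputable def opJ (α : ℝ) (i : ImagUnit) : bergmanSpace α i →ₗ[(ℍ[ℝ])ᵐᵒᵖ] bergmanSpace α i where
  toFun f := ⟨extL i fun z => i.1 * f.1 z, extL_mem f.2⟩
  map_add' f g := by
    ext1; funext x
    simp only [Submodule.coe_add, Pi.add_apply, extL, mul_add]
    split_ifs
    · abel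
    · abel
  map_smul' c f := by
    ext1; funext x
    simp only [SetLike.val_smul, Pi.smul_apply, extL, RingHom.id_apply, smul_eq_mul_unop]
    split_ifs
    · simp only [add_mul, mul_assoc]
    · simp

/-- A right linear operator `T` is bounded if `sup {‖T f‖ : ‖f‖ = 1} < ∞`. -/
def IsBoundedOp {α : ℝ} {i : ImagUnit} (T : bergmanSpace α i →ₗ[(ℍ[ℝ])ᵐᵒᵖ] bergmanSpace α i) : Prop :=
  BddAbove {r : ℝ | ∃ f : bergmanSpace α i, bNorm f = 1 ∧ r = bNorm (T f)}

/-- The operator norm `‖T‖ = sup {‖T f‖ : ‖f‖ = 1}`. -/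
noncomputable def opNorm {α : ℝ} {i : ImagUnit}
    (T : bergmanSpace α i →ₗ[(ℍ[ℝ])ᵐᵒᵖ] bergmanSpace α i) : ℝ :=
  sSup {r : ℝ | ∃ f : bergmanSpace α i, bNorm f = 1 ∧ r = bNorm (T f)}

/-- The set `B_J` of bounded right linear operators on the Bergman space that commute with `J`. -/
def boundedCommJ (α : ℝ) (i : ImagUnit) :
    Set (bergmanSpace α i →ₗ[(ℍ[ℝ])ᵐᵒᵖ] bergmanSpace α i) :=
  {T | IsBoundedOp T ∧ T ∘ₗ opJ α i = opJ α i ∘ₗ T}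

/-- The reproducing kernel function `K_w`: the (unique) element of the Bergman space with
`⟨K_w, f⟩ = f w` for every `f` in the space. -/
noncomputable def kernel (α : ℝ) (i : ImagUnit) (w : ℍ[ℝ]) : bergmanSpace α i :=
  Classical.epsilon fun K => ∀ f : bergmanSpace α i, bInner K f = f.1 w

/-- The normalized reproducing kernel `k_w = K_w / √(K_w w)`; here `K_w w = ‖K_w‖²` is real. -/
noncomputable def normKernel (α : ℝ) (i : ImagUnit) (w : ℍ[ℝ]) : bergmanSpace α i :=
  op (((√((kernel α i w).1 w).re)⁻¹ : ℝ) : ℍ[ℝ]) • kernel α i w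

/-- The Berezin transform `T̃ z = ⟨k_z, T k_z⟩`. -/
noncomputable def berezin {α : ℝ} {i : ImagUnit}
    (T : bergmanSpace α i →ₗ[(ℍ[ℝ])ᵐᵒᵖ] bergmanSpace α i) (z : ℍ[ℝ]) : ℍ[ℝ] :=
  bInner (normKernel α i z) (T (normKernel α i z))

/-- The pseudo-hyperbolic metric on a slice disc. -/
noncomputable def pseudoHyp (z w : ℍ[ℝ]) : ℝ := ‖z - w‖ / ‖1 - z * star w‖

/-- The Bergman metric on a slice disc. -/
noncomputable def bergmanMetric (z w : ℍ[ℝ]) : ℝ :=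
  1 / 2 * Real.log ((1 + pseudoHyp z w) / (1 - pseudoHyp z w))

end SliceBergman

/-!
If `u`, `v` are unit vectors whose scalar product `c` is real, polarisation gives
`|⟨u, Tu⟩ - ⟨v, Tv⟩| ≤ 2 ‖T‖ √(1 - c ^ 2)`, and the difference `T` of the projections onto `u` and
`v` attains equality, since `T ^ 3 = (1 - c ^ 2) T`. For the normalised kernels `u = k_p`,
`v = k_q` the scalar product lies in `ℂ_i`; operators commuting with `J` do not see a factor from
`ℂ_i` of modulus one, so `c` can be made real, with `c ^ 2 = (1 - ρ(p, q) ^ 2) ^ (α + 2)`. The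
reproducing kernel itself comes from the mean value property at the origin, transported by the
Möbius involutions of the disc. Finally `√(1 - (1 - ρ ^ 2) ^ (α + 2)) ≤ √(α + 2) artanh ρ`, with
equality to first order as `ρ → 0`, and `β = artanh ρ`.
-/

namespace SliceBergman

open Metric Set Filter Topology
open scoped Real

section DiscMeasure

variable {α : ℝ}

theorem one_sub_norm_sq_pos {z : ℂ} (hz : ‖z‖ < 1) : 0 < 1 - ‖z‖ ^ 2 := by
  nlinarith [norm_nonneg z]

/-- The density of `discMeasure α` with respect to Lebesgue measure on the unit disc. Outside the
disc its values are of no interest. -/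
noncomputable def discWeight (α : ℝ) (z : ℂ) : ℝ := (α + 1) / π * (1 - ‖z‖ ^ 2) ^ α

theorem measurable_discWeight (α : ℝ) : Measurable (discWeight α) :=
  (((measurable_norm.pow_const 2).const_sub 1).pow_const α).const_mul _

theorem discWeight_nonneg (hα : -1 < α) {z : ℂ} (hz : z ∈ ball (0 : ℂ) 1) :
    0 ≤ discWeight α z := by
  have h : 0 < 1 - ‖z‖ ^ 2 := one_sub_norm_sq_pos (mem_ball_zero_iff.mp hz)
  have : 0 < α + 1 := by linarith
  unfold discWeight
  positivity

theorem discMeasure_eq_withDensity (α : ℝ) :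
    discMeasure α = (volume.restrict (ball (0 : ℂ) 1)).withDensity
      fun z => ENNReal.ofReal (discWeight α z) := rfl

theorem ae_mem_ball_discMeasure (α : ℝ) : ∀ᵐ z ∂discMeasure α, z ∈ ball (0 : ℂ) 1 :=
  (withDensity_absolutelyContinuous _ _).ae_le (ae_restrict_mem measurableSet_ball)

theorem integral_discMeasure {E : Type*} [NormedAddCommGroup E] [NormedSpace ℝ E]
    (hα : -1 < α) (g : ℂ → E) :
    ∫ z, g z ∂discMeasure α = ∫ z in ball (0 : ℂ) 1, discWeight α z • g z := by
  rw [discMeasure_eq_withDensity, integral_withDensity_eq_integral_toReal_smul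
    (measurable_discWeight α).ennreal_ofReal (by simp)]
  refine setIntegral_congr_fun measurableSet_ball fun z hz => ?_
  simp only [ENNReal.toReal_ofReal (discWeight_nonneg hα hz)]

theorem integrable_discMeasure_iff {E : Type*} [NormedAddCommGroup E] [NormedSpace ℝ E]
    (hα : -1 < α) {g : ℂ → E} :
    Integrable g (discMeasure α) ↔
      IntegrableOn (fun z => discWeight α z • g z) (ball (0 : ℂ) 1) := by
  rw [discMeasure_eq_withDensity, integrable_withDensity_iff_integrable_smul'
    (measurable_discWeight α).ennreal_ofReal (by simp)]
  refine integrableOn_congr_fun (fun z hz => ?_) measurableSet_ball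
  simp only [ENNReal.toReal_ofReal (discWeight_nonneg hα hz)]

theorem setIntegral_ball_fun_norm {E : Type*} [NormedAddCommGroup E] [NormedSpace ℝ E]
    (f : ℝ → E) (R : ℝ) :
    ∫ z in ball (0 : ℂ) R, f ‖z‖ = (2 * π) • ∫ r in Ioo 0 R, r • f r := by
  have hind : ∀ y : ℝ, y ^ (Module.finrank ℝ ℂ - 1) • (Iio R).indicator f y =
      (Iio R).indicator (fun r => r • f r) y := fun y => by
    rw [Complex.finrank_real_complex, pow_one, indicator_smul_apply]
  have hball : (ball (0 : ℂ) R).indicator (fun z => f ‖z‖) = fun z => (Iio R).indicator f ‖z‖ := by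
    ext z
    simp [indicator]
  rw [← integral_indicator measurableSet_ball, hball, integral_fun_norm_addHaar]
  simp_rw [hind]
  rw [setIntegral_indicator measurableSet_Iio, Ioi_inter_Iio]
  simp [Measure.real, Complex.volume_ball, Complex.finrank_real_complex, mul_smul,
    ofNat_smul_eq_nsmul]

theorem hasDerivAt_neg_one_sub_sq_rpow (α : ℝ) {x : ℝ} (hx : x ∈ Ioo (0 : ℝ) 1) :
    HasDerivAt (fun x : ℝ => -(1 - x ^ 2) ^ (α + 1)) (2 * (α + 1) * (x * (1 - x ^ 2) ^ α)) x := by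
  have hpos : 0 < 1 - x ^ 2 := by nlinarith [hx.1, hx.2]
  have hinner : HasDerivAt (fun x : ℝ => 1 - x ^ 2) (-(2 * x)) x := by
    simpa using (hasDerivAt_pow 2 x).const_sub 1
  refine (hinner.rpow_const (p := α + 1) (Or.inl hpos.ne')).neg.congr_deriv ?_
  rw [add_sub_cancel_right]
  ring

theorem continuous_neg_one_sub_sq_rpow (hα : -1 < α) :
    Continuous fun x : ℝ => -(1 - x ^ 2) ^ (α + 1) :=
  ((continuous_const.sub (continuous_id.pow 2)).rpow_const fun _ => Or.inr (by linarith)).neg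

theorem integrableOn_mul_one_sub_sq_rpow (hα : -1 < α) :
    IntegrableOn (fun x : ℝ => 2 * (α + 1) * (x * (1 - x ^ 2) ^ α)) (Ioc 0 1) := by
  refine intervalIntegral.integrableOn_deriv_of_nonneg
    (continuous_neg_one_sub_sq_rpow hα).continuousOn
    (fun x hx => hasDerivAt_neg_one_sub_sq_rpow α hx) fun x hx => ?_
  have hpos : 0 < 1 - x ^ 2 := by nlinarith [hx.1, hx.2]
  have hα1 : 0 < α + 1 := by linarith
  have hx0 : 0 < x := hx.1
  positivity

theorem integral_mul_one_sub_sq_rpow (hα : -1 < α) :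
    ∫ x in Ioc (0 : ℝ) 1, 2 * (α + 1) * (x * (1 - x ^ 2) ^ α) = 1 := by
  rw [← intervalIntegral.integral_of_le zero_le_one,
    intervalIntegral.integral_eq_sub_of_hasDerivAt_of_le zero_le_one
      (continuous_neg_one_sub_sq_rpow hα).continuousOn
      (fun x hx => hasDerivAt_neg_one_sub_sq_rpow α hx)
      ((intervalIntegrable_iff_integrableOn_Ioc_of_le zero_le_one).mpr
        (integrableOn_mul_one_sub_sq_rpow hα))]
  simp [Real.zero_rpow (show α + 1 ≠ 0 by linarith)]

theorem smul_radial_discWeight (α r : ℝ) :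
    r • ((α + 1) / π * (1 - r ^ 2) ^ α) =
      (2 * π)⁻¹ * (2 * (α + 1) * (r * (1 - r ^ 2) ^ α)) := by
  have := Real.pi_ne_zero
  simp only [smul_eq_mul]
  field_simp

theorem integrableOn_discWeight (hα : -1 < α) :
    IntegrableOn (discWeight α) (ball (0 : ℂ) 1) := by
  refine (integrableOn_fun_norm_addHaar (volume : Measure ℂ)
    (f := fun r => (α + 1) / π * (1 - r ^ 2) ^ α)).mpr ?_
  simp only [Complex.finrank_real_complex, Nat.add_one_sub_one, pow_one, smul_radial_discWeight]
  exact ((integrableOn_mul_one_sub_sq_rpow hα).mono_set Ioo_subset_Ioc_self).const_mul _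

theorem setIntegral_discWeight (hα : -1 < α) : ∫ z in ball (0 : ℂ) 1, discWeight α z = 1 := by
  have h := setIntegral_ball_fun_norm (fun r => (α + 1) / π * (1 - r ^ 2) ^ α) 1
  simp only [smul_radial_discWeight] at h
  simp only [discWeight]
  rw [h, integral_const_mul, ← integral_Ioc_eq_integral_Ioo, integral_mul_one_sub_sq_rpow hα,
    mul_one, smul_eq_mul, mul_inv_cancel₀ (by positivity)]

theorem isProbabilityMeasure_discMeasure (hα : -1 < α) :
    IsProbabilityMeasure (discMeasure α) := by
  refine ⟨?_⟩
  rw [discMeasure_eq_withDensity, withDensity_apply _ MeasurableSet.univ, Measure.restrict_univ,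
    ← ofReal_integral_eq_lintegral_ofReal (integrableOn_discWeight hα), setIntegral_discWeight hα,
    ENNReal.ofReal_one]
  filter_upwards [ae_restrict_mem measurableSet_ball] with z hz
  exact discWeight_nonneg hα hz

theorem measurePreserving_mul_discMeasure (α : ℝ) {c : ℂ} (hc : ‖c‖ = 1) :
    MeasurePreserving (fun z => c * z) (discMeasure α) (discMeasure α) := by
  have hm : Measurable fun z : ℂ => c * z := measurable_const_mul c
  have hball : (fun z : ℂ => c * z) ⁻¹' ball 0 1 = ball 0 1 := by
    ext z
    simp [hc]
  have hvol : MeasurePreserving (fun z : ℂ => c * z) (volume.restrict (ball 0 1))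
      (volume.restrict (ball 0 1)) := by
    have h : MeasurePreserving (fun z : ℂ => c * z) volume volume :=
      (rotation (⟨c, mem_sphere_zero_iff_norm.mpr hc⟩ : Circle)).measurePreserving
    simpa only [hball] using h.restrict_preimage (s := ball (0 : ℂ) 1) measurableSet_ball
  refine ⟨hm, Measure.ext fun s hs => ?_⟩
  rw [Measure.map_apply hm hs, discMeasure_eq_withDensity, withDensity_apply _ hs,
    withDensity_apply _ (hm hs), ← lintegral_indicator hs, ← lintegral_indicator (hm hs),
    ← hvol.lintegral_comp ((measurable_discWeight α).ennreal_ofReal.indicator hs)]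
  refine lintegral_congr fun z => ?_
  simp only [indicator, mem_preimage, discWeight, norm_mul, hc, one_mul]
  rfl

end DiscMeasure

section MeanValue

theorem circleAverage_comp_mul_of_mem_ball {E : Type*} [NormedAddCommGroup E] [NormedSpace ℂ E]
    [CompleteSpace E] {g : ℂ → E} (hg : DifferentiableOn ℂ g (ball 0 1)) {z : ℂ}
    (hz : z ∈ ball (0 : ℂ) 1) :
    Real.circleAverage (fun ζ => g (ζ * z)) 0 1 = g 0 := by
  have hd : DifferentiableOn ℂ (fun ζ => g (ζ * z)) (closedBall 0 |1|) := by
    refine hg.comp (differentiable_id.mul_const z).differentiableOn fun ζ hζ => ?_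
    rw [abs_one, mem_closedBall_zero_iff] at hζ
    simp only [mem_ball_zero_iff, norm_mul] at hz ⊢
    exact (mul_le_of_le_one_left (norm_nonneg z) hζ).trans_lt hz
  rw [DiffContOnCl.circleAverage (hd.diffContOnCl_ball subset_rfl), zero_mul]

theorem integral_circleAverage_comp_mul {E : Type*} [NormedAddCommGroup E] [NormedSpace ℝ E]
    [CompleteSpace E] {μ : Measure ℂ} [SFinite μ]
    (hμ : ∀ c : ℂ, ‖c‖ = 1 → MeasurePreserving (fun z => c * z) μ μ) {g : ℂ → E}
    (hg : Integrable g μ) :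
    ∫ z, Real.circleAverage (fun ζ => g (ζ * z)) 0 1 ∂μ = ∫ z, g z ∂μ := by
  have h2π : (0 : ℝ) < 2 * π := by positivity
  have hcircle : ∀ θ : ℝ, ‖circleMap 0 1 θ‖ = 1 := fun θ => by simp
  have hskew : MeasurePreserving (fun p : ℝ × ℂ => (p.1, circleMap 0 1 p.1 * p.2))
      ((volume.restrict (Ioc 0 (2 * π))).prod μ) ((volume.restrict (Ioc 0 (2 * π))).prod μ) := by
    refine MeasurePreserving.skew_product (g := fun θ z => circleMap 0 1 θ * z)
      (MeasurePreserving.id _) ?_ (Eventually.of_forall fun θ => (hμ _ (hcircle θ)).map_eq)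
    exact (((continuous_circleMap 0 1).comp continuous_fst).mul continuous_snd).measurable
  have hint : Integrable (Function.uncurry fun (θ : ℝ) (z : ℂ) => g (circleMap 0 1 θ * z))
      ((volume.restrict (Ioc 0 (2 * π))).prod μ) :=
    hskew.integrable_comp_of_integrable (hg.comp_snd _)
  have hrot : ∀ θ : ℝ, ∫ z, g (circleMap 0 1 θ * z) ∂μ = ∫ z, g z ∂μ := fun θ => by
    refine (hμ _ (hcircle θ)).integral_comp ?_ g
    exact (MeasurableEquiv.mulLeft₀ (circleMap 0 1 θ)
      (norm_ne_zero_iff.mp (by simp [hcircle]))).measurableEmbedding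
  simp_rw [Real.circleAverage, integral_smul, intervalIntegral.integral_of_le h2π.le]
  rw [← integral_integral_swap hint]
  simp_rw [hrot]
  rw [setIntegral_const, Real.volume_real_Ioc_of_le h2π.le, sub_zero, inv_smul_smul₀ h2π.ne']

theorem integral_eq_apply_zero_of_rotationInvariant {E : Type*} [NormedAddCommGroup E]
    [NormedSpace ℂ E] [CompleteSpace E] {μ : Measure ℂ} [IsProbabilityMeasure μ]
    (hμ : ∀ c : ℂ, ‖c‖ = 1 → MeasurePreserving (fun z => c * z) μ μ)
    (hball : ∀ᵐ z ∂μ, z ∈ ball (0 : ℂ) 1) {g : ℂ → E} (hg : DifferentiableOn ℂ g (ball 0 1))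
    (hint : Integrable g μ) :
    ∫ z, g z ∂μ = g 0 := by
  have hmean : ∀ᵐ z ∂μ, Real.circleAverage (fun ζ => g (ζ * z)) 0 1 = g 0 := by
    filter_upwards [hball] with z hz using circleAverage_comp_mul_of_mem_ball hg hz
  rw [← integral_circleAverage_comp_mul hμ hint, integral_congr_ae hmean]
  simp

end MeanValue

section DiscKernel

variable {α : ℝ} {w u : ℂ}

/-- The reproducing kernel `z ↦ (1 - w̄ z) ^ (-(α + 2))` of the complex weighted Bergman space of
the unit disc, with the principal branch of the power. -/
noncomputable def discKernel (α : ℝ) (w z : ℂ) : ℂ := (1 - star w * z) ^ (-((α + 2 : ℝ) : ℂ))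

/-- The Möbius involution of the unit disc that exchanges `0` and `w`. -/
noncomputable def discInvolution (w u : ℂ) : ℂ := (w - u) / (1 - star w * u)

theorem one_sub_star_mul_self (w : ℂ) : 1 - star w * w = ((1 - ‖w‖ ^ 2 : ℝ) : ℂ) := by
  rw [Complex.star_def, Complex.conj_mul']
  push_cast
  rfl

theorem one_sub_norm_le_norm_one_sub_star_mul (hu : ‖u‖ < 1) :
    1 - ‖w‖ ≤ ‖1 - star w * u‖ := by
  have h := norm_sub_norm_le (1 : ℂ) (star w * u)
  rw [norm_one, norm_mul, norm_star] at h
  nlinarith [norm_nonneg w]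

theorem one_sub_star_mul_ne_zero (hw : ‖w‖ < 1) (hu : ‖u‖ < 1) : 1 - star w * u ≠ 0 :=
  norm_pos_iff.mp ((sub_pos.mpr hw).trans_le (one_sub_norm_le_norm_one_sub_star_mul hu))

theorem one_sub_star_mul_mem_slitPlane (hw : ‖w‖ < 1) (hu : ‖u‖ < 1) :
    1 - star w * u ∈ Complex.slitPlane := by
  have hlt : ‖-(star w * u)‖ < 1 := by
    rw [norm_neg, norm_mul, norm_star]
    nlinarith [norm_nonneg w, norm_nonneg u]
  simpa only [sub_eq_add_neg] using Complex.mem_slitPlane_of_norm_lt_one hlt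

theorem discKernel_zero_right (α : ℝ) (w : ℂ) : discKernel α w 0 = 1 := by simp [discKernel]

theorem discInvolution_zero_right (w : ℂ) : discInvolution w 0 = w := by simp [discInvolution]

theorem measurable_discKernel (α : ℝ) (w : ℂ) : Measurable (discKernel α w) :=
  ((measurable_const_mul _).const_sub 1).pow_const _

theorem differentiableAt_discKernel (α : ℝ) (hw : ‖w‖ < 1) (hu : ‖u‖ < 1) :
    DifferentiableAt ℂ (discKernel α w) u :=
  ((differentiableAt_id.const_mul _).const_sub 1).cpow_const
    (one_sub_star_mul_mem_slitPlane hw hu)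

theorem norm_discKernel (α : ℝ) (w u : ℂ) :
    ‖discKernel α w u‖ = ‖1 - star w * u‖ ^ (-(α + 2)) := by
  rw [discKernel, ← Complex.ofReal_neg, Complex.norm_cpow_real]

theorem ae_norm_discKernel_le (hα : -1 < α) (hw : ‖w‖ < 1) :
    ∀ᵐ z ∂discMeasure α, ‖discKernel α w z‖ ≤ (1 - ‖w‖) ^ (-(α + 2)) := by
  filter_upwards [ae_mem_ball_discMeasure α] with z hz
  rw [norm_discKernel]
  exact Real.rpow_le_rpow_of_nonpos (by linarith)
    (one_sub_norm_le_norm_one_sub_star_mul (mem_ball_zero_iff.mp hz)) (by linarith)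

theorem discKernel_self (α : ℝ) (hw : ‖w‖ < 1) :
    discKernel α w w = (((1 - ‖w‖ ^ 2) ^ (-(α + 2)) : ℝ) : ℂ) := by
  rw [discKernel, one_sub_star_mul_self, ← Complex.ofReal_neg,
    Complex.ofReal_cpow (one_sub_norm_sq_pos hw).le]

theorem one_sub_norm_sq_discInvolution (hw : ‖w‖ < 1) (hu : ‖u‖ < 1) :
    1 - ‖discInvolution w u‖ ^ 2 = (1 - ‖w‖ ^ 2) * (1 - ‖u‖ ^ 2) / ‖1 - star w * u‖ ^ 2 := by
  have h : ‖1 - star w * u‖ ^ 2 ≠ 0 := by simpa using one_sub_star_mul_ne_zero hw hu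
  rw [discInvolution, norm_div, div_pow, eq_div_iff h, sub_mul, div_mul_cancel₀ _ h]
  simp only [← Complex.normSq_eq_norm_sq, Complex.normSq_apply, Complex.sub_re, Complex.sub_im,
    Complex.mul_re, Complex.mul_im, Complex.one_re, Complex.one_im, Complex.star_def,
    Complex.conj_re, Complex.conj_im]
  ring

theorem mapsTo_discInvolution (hw : ‖w‖ < 1) :
    MapsTo (discInvolution w) (ball 0 1) (ball 0 1) := by
  intro u hu
  rw [mem_ball_zero_iff] at hu ⊢
  have hden : 0 < ‖1 - star w * u‖ := norm_pos_iff.mpr (one_sub_star_mul_ne_zero hw hu)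
  have hdiff : 0 < 1 - ‖discInvolution w u‖ ^ 2 := by
    rw [one_sub_norm_sq_discInvolution hw hu]
    have := one_sub_norm_sq_pos hw
    have := one_sub_norm_sq_pos hu
    positivity
  exact (sq_lt_one_iff₀ (norm_nonneg _)).mp (sub_pos.mp hdiff)

theorem one_sub_star_mul_discInvolution (hw : ‖w‖ < 1) (hu : ‖u‖ < 1) :
    1 - star w * discInvolution w u = (1 - star w * w) * (1 - star w * u)⁻¹ := by
  have h := one_sub_star_mul_ne_zero hw hu
  rw [discInvolution]
  field_simp
  ring

theorem discInvolution_discInvolution (hw : ‖w‖ < 1) (hu : ‖u‖ < 1) :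
    discInvolution w (discInvolution w u) = u := by
  have h := one_sub_star_mul_ne_zero hw hu
  have hww := one_sub_star_mul_ne_zero hw hw
  rw [discInvolution, one_sub_star_mul_discInvolution hw hu, discInvolution,
    div_eq_iff (mul_ne_zero hww (inv_ne_zero h)), ← div_eq_mul_inv, sub_eq_iff_eq_add,
    mul_div_assoc', ← add_div, eq_div_iff h]
  ring

theorem bijOn_discInvolution (hw : ‖w‖ < 1) :
    BijOn (discInvolution w) (ball 0 1) (ball 0 1) := by
  have h : LeftInvOn (discInvolution w) (discInvolution w) (ball 0 1) := fun u hu =>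
    discInvolution_discInvolution hw (mem_ball_zero_iff.mp hu)
  exact InvOn.bijOn ⟨h, h⟩ (mapsTo_discInvolution hw) (mapsTo_discInvolution hw)

theorem hasDerivAt_discInvolution (hw : ‖w‖ < 1) (hu : ‖u‖ < 1) :
    HasDerivAt (discInvolution w) (-(1 - star w * w) / (1 - star w * u) ^ 2) u := by
  have hnum : HasDerivAt (fun u : ℂ => w - u) (-1) u := (hasDerivAt_id u).const_sub w
  have hden : HasDerivAt (fun u : ℂ => 1 - star w * u) (-star w) u := by
    simpa using ((hasDerivAt_id u).const_mul (star w)).const_sub 1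
  refine (hnum.div hden (one_sub_star_mul_ne_zero hw hu)).congr_deriv ?_
  congr 1
  ring

theorem discKernel_discInvolution_mul (α : ℝ) (hw : ‖w‖ < 1) (hu : ‖u‖ < 1) :
    discKernel α w (discInvolution w u) * discKernel α w u = discKernel α w w := by
  have hR : 0 < 1 - ‖w‖ ^ 2 := one_sub_norm_sq_pos hw
  have hd0 := one_sub_star_mul_ne_zero hw hu
  have hR0 : ((1 - ‖w‖ ^ 2 : ℝ) : ℂ) ≠ 0 := Complex.ofReal_ne_zero.mpr hR.ne'
  have hlog : Complex.log (((1 - ‖w‖ ^ 2 : ℝ) : ℂ) * (1 - star w * u)⁻¹) +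
      Complex.log (1 - star w * u) = Complex.log ((1 - ‖w‖ ^ 2 : ℝ) : ℂ) := by
    rw [Complex.log_ofReal_mul hR (inv_ne_zero hd0), Complex.log_inv _
      (Complex.slitPlane_arg_ne_pi (one_sub_star_mul_mem_slitPlane hw hu)), neg_add_cancel_right,
      Complex.ofReal_log hR.le]
  rw [discKernel, discKernel, discKernel, one_sub_star_mul_discInvolution hw hu,
    one_sub_star_mul_self, Complex.cpow_def_of_ne_zero (mul_ne_zero hR0 (inv_ne_zero hd0)),
    Complex.cpow_def_of_ne_zero hd0, Complex.cpow_def_of_ne_zero hR0, ← Complex.exp_add, ← add_mul,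
    hlog]

theorem norm_sq_deriv_mul_discWeight_discInvolution (α : ℝ) (hw : ‖w‖ < 1) (hu : ‖u‖ < 1) :
    ‖-(1 - star w * w) / (1 - star w * u) ^ 2‖ ^ 2 * discWeight α (discInvolution w u) =
      discWeight α u * ((1 - ‖w‖ ^ 2) ^ (α + 2) * ‖discKernel α w u‖ ^ 2) := by
  have hR : 0 < 1 - ‖w‖ ^ 2 := one_sub_norm_sq_pos hw
  have hr : 0 < 1 - ‖u‖ ^ 2 := one_sub_norm_sq_pos hu
  have hd : 0 < ‖1 - star w * u‖ := norm_pos_iff.mpr (one_sub_star_mul_ne_zero hw hu)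
  rw [norm_discKernel, discWeight, one_sub_norm_sq_discInvolution hw hu, discWeight,
    one_sub_star_mul_self, norm_div, norm_neg, Complex.norm_real, Real.norm_of_nonneg hR.le,
    norm_pow, Real.rpow_pow_comm hd.le]
  generalize ‖1 - star w * u‖ = d at hd
  have hd2 : 0 < d ^ 2 := by positivity
  rw [Real.div_rpow (by positivity) hd2.le, Real.mul_rpow hR.le hr.le, Real.rpow_neg hd2.le,
    Real.rpow_add hR, Real.rpow_add hd2, Real.rpow_two, Real.rpow_two]
  have hne : (d ^ 2) ^ α ≠ 0 := (Real.rpow_pos_of_pos hd2 _).ne'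
  field_simp

theorem abs_det_restrictScalars_toSpanSingleton (c : ℂ) :
    |((ContinuousLinearMap.toSpanSingleton ℂ c).restrictScalars ℝ : ℂ →L[ℝ] ℂ).det| = ‖c‖ ^ 2 := by
  have h : ((ContinuousLinearMap.toSpanSingleton ℂ c).restrictScalars ℝ : ℂ →L[ℝ] ℂ).det =
      Algebra.norm ℝ c :=
    (LinearMap.det_restrictScalars (R := ℝ) (f := LinearMap.toSpanSingleton ℂ ℂ c)).trans (by simp)
  rw [h, Algebra.norm_complex_apply, Complex.normSq_eq_norm_sq, abs_of_nonneg (by positivity)]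

theorem hasFDerivWithinAt_discInvolution (hw : ‖w‖ < 1) (hu : u ∈ ball (0 : ℂ) 1) :
    HasFDerivWithinAt (discInvolution w)
      ((ContinuousLinearMap.toSpanSingleton ℂ
        (-(1 - star w * w) / (1 - star w * u) ^ 2)).restrictScalars ℝ) (ball 0 1) u :=
  ((hasDerivAt_discInvolution hw
    (mem_ball_zero_iff.mp hu)).hasFDerivAt.restrictScalars ℝ).hasFDerivWithinAt

section ChangeOfVariables

variable {E : Type*} [NormedAddCommGroup E] [NormedSpace ℝ E]

theorem abs_det_smul_discWeight_smul_comp_discInvolution (hw : ‖w‖ < 1)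
    (hu : u ∈ ball (0 : ℂ) 1) (F : ℂ → E) :
    |((ContinuousLinearMap.toSpanSingleton ℂ
        (-(1 - star w * w) / (1 - star w * u) ^ 2)).restrictScalars ℝ : ℂ →L[ℝ] ℂ).det| •
        (discWeight α (discInvolution w u) • F (discInvolution w u)) =
      discWeight α u •
        (((1 - ‖w‖ ^ 2) ^ (α + 2) * ‖discKernel α w u‖ ^ 2) • F (discInvolution w u)) := by
  rw [abs_det_restrictScalars_toSpanSingleton, smul_smul, smul_smul,
    norm_sq_deriv_mul_discWeight_discInvolution α hw (mem_ball_zero_iff.mp hu)]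

theorem integral_discMeasure_eq_comp_discInvolution (hα : -1 < α) (hw : ‖w‖ < 1) (F : ℂ → E) :
    ∫ z, F z ∂discMeasure α =
      ∫ u, ((1 - ‖w‖ ^ 2) ^ (α + 2) * ‖discKernel α w u‖ ^ 2) • F (discInvolution w u)
        ∂discMeasure α := by
  have h := integral_image_eq_integral_abs_det_fderiv_smul volume measurableSet_ball
    (fun _ => hasFDerivWithinAt_discInvolution hw) (bijOn_discInvolution hw).injOn
    fun z => discWeight α z • F z
  rw [(bijOn_discInvolution hw).image_eq] at h
  rw [integral_discMeasure hα, integral_discMeasure hα, h]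
  exact setIntegral_congr_fun measurableSet_ball fun u hu =>
    abs_det_smul_discWeight_smul_comp_discInvolution hw hu F

theorem integrable_discMeasure_iff_comp_discInvolution (hα : -1 < α) (hw : ‖w‖ < 1) {F : ℂ → E} :
    Integrable F (discMeasure α) ↔
      Integrable (fun u => ((1 - ‖w‖ ^ 2) ^ (α + 2) * ‖discKernel α w u‖ ^ 2) •
        F (discInvolution w u)) (discMeasure α) := by
  have h := integrableOn_image_iff_integrableOn_abs_det_fderiv_smul volume measurableSet_ball
    (fun _ => hasFDerivWithinAt_discInvolution hw) (bijOn_discInvolution hw).injOn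
    fun z => discWeight α z • F z
  rw [(bijOn_discInvolution hw).image_eq] at h
  rw [integrable_discMeasure_iff hα, integrable_discMeasure_iff hα, h]
  exact integrableOn_congr_fun (fun u hu =>
    abs_det_smul_discWeight_smul_comp_discInvolution hw hu F) measurableSet_ball

end ChangeOfVariables

section ReproducingProperty

variable {E : Type*} [NormedAddCommGroup E] [NormedSpace ℂ E]

theorem norm_sq_discKernel_smul_star_discKernel_discInvolution_smul (α : ℝ) (hw : ‖w‖ < 1)
    (hu : ‖u‖ < 1) (x : E) :
    ((1 - ‖w‖ ^ 2) ^ (α + 2) * ‖discKernel α w u‖ ^ 2) •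
      (star (discKernel α w (discInvolution w u)) • x) = discKernel α w u • x := by
  have hR : 0 < 1 - ‖w‖ ^ 2 := one_sub_norm_sq_pos hw
  have h := congrArg star (discKernel_discInvolution_mul α hw hu)
  rw [discKernel_self α hw, star_mul', Complex.star_def, Complex.conj_ofReal,
    Real.rpow_neg hR.le, Complex.ofReal_inv] at h
  have hpow : (((1 - ‖w‖ ^ 2) ^ (α + 2) : ℝ) : ℂ) ≠ 0 :=
    Complex.ofReal_ne_zero.mpr (Real.rpow_pos_of_pos hR _).ne'
  have hsq : ((‖discKernel α w u‖ ^ 2 : ℝ) : ℂ) =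
      discKernel α w u * star (discKernel α w u) := by
    rw [Complex.star_def, Complex.mul_conj', Complex.ofReal_pow]
  rw [← Complex.coe_smul, smul_smul, Complex.ofReal_mul, hsq, Complex.star_def]
  congr 1
  linear_combination (((1 - ‖w‖ ^ 2) ^ (α + 2) : ℝ) : ℂ) * discKernel α w u * h +
    discKernel α w u * mul_inv_cancel₀ hpow

theorem integral_star_discKernel_smul [CompleteSpace E] (hα : -1 < α) (hw : ‖w‖ < 1) {f : ℂ → E}
    (hf : DifferentiableOn ℂ f (ball 0 1)) (hint : Integrable f (discMeasure α)) :
    ∫ z, star (discKernel α w z) • f z ∂discMeasure α = f w := by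
  have := isProbabilityMeasure_discMeasure hα
  have hcov : (fun u => ((1 - ‖w‖ ^ 2) ^ (α + 2) * ‖discKernel α w u‖ ^ 2) •
      (star (discKernel α w (discInvolution w u)) • f (discInvolution w u))) =ᵐ[discMeasure α]
      fun u => discKernel α w u • f (discInvolution w u) := by
    filter_upwards [ae_mem_ball_discMeasure α] with u hu
    exact norm_sq_discKernel_smul_star_discKernel_discInvolution_smul α hw
      (mem_ball_zero_iff.mp hu) _
  have hintK : Integrable (fun z => star (discKernel α w z) • f z) (discMeasure α) := by
    refine hint.bdd_smul ((1 - ‖w‖) ^ (-(α + 2))) ?_ ?_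
    · exact (continuous_star.measurable.comp (measurable_discKernel α w)).aestronglyMeasurable
    · simpa only [norm_star] using ae_norm_discKernel_le hα hw
  have hdiff : DifferentiableOn ℂ (fun u => discKernel α w u • f (discInvolution w u))
      (ball 0 1) := by
    refine DifferentiableOn.smul (fun u hu => (differentiableAt_discKernel α hw
      (mem_ball_zero_iff.mp hu)).differentiableWithinAt) (hf.comp (fun u hu => ?_)
        (mapsTo_discInvolution hw))
    exact (hasDerivAt_discInvolution hw
      (mem_ball_zero_iff.mp hu)).differentiableAt.differentiableWithinAt
  rw [integral_discMeasure_eq_comp_discInvolution hα hw, integral_congr_ae hcov,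
    integral_eq_apply_zero_of_rotationInvariant (fun _ => measurePreserving_mul_discMeasure α)
      (ae_mem_ball_discMeasure α) hdiff
      (((integrable_discMeasure_iff_comp_discInvolution hα hw).mp hintK).congr hcov),
    discKernel_zero_right, discInvolution_zero_right, one_smul]

end ReproducingProperty

end DiscKernel

section Slice

variable (i : ImagUnit)

/-- The isometric embedding `x + I y ↦ x + i y` of `ℂ` onto the slice plane `ℂ_i`. -/
noncomputable def sliceEmb : ℂ →ₐ[ℝ] ℍ[ℝ] := Complex.liftAux i.1 (unit_mul_self i)

theorem sliceEmb_apply (z : ℂ) : sliceEmb i z = pt i.1 z.re z.im := by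
  rw [sliceEmb, Complex.liftAux_apply, pt, Quaternion.mul_coe_eq_smul]
  rfl

theorem restr_apply (f : ℍ[ℝ] → ℍ[ℝ]) (z : ℂ) : restr i f z = f (sliceEmb i z) := by
  rw [restr, sliceEmb_apply]

theorem norm_sliceEmb (z : ℂ) : ‖sliceEmb i z‖ = ‖z‖ := by
  rw [← sq_eq_sq₀ (norm_nonneg _) (norm_nonneg _), sliceEmb_apply, norm_pt_sq,
    ← Complex.normSq_eq_norm_sq, Complex.normSq_apply]
  ring

theorem star_unit : star i.1 = -i.1 := Quaternion.star_eq_neg.mpr i.2.1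

theorem star_sliceEmb (z : ℂ) : star (sliceEmb i z) = sliceEmb i (star z) := by
  simp [sliceEmb, Complex.liftAux_apply, star_unit]

theorem sliceEmb_I : sliceEmb i Complex.I = i.1 := by simp [sliceEmb]

theorem sliceEmb_ofReal (r : ℝ) : sliceEmb i r = (r : ℍ[ℝ]) := by simp [sliceEmb]

theorem sliceEmb_mem_unitBall_iff (z : ℂ) :
    sliceEmb i z ∈ unitBall ↔ z ∈ ball (0 : ℂ) 1 := by
  rw [unitBall, mem_ball_zero_iff, mem_ball_zero_iff, norm_sliceEmb]

theorem exists_sliceEmb_of_mem_sliceDisc {q : ℍ[ℝ]} (hq : q ∈ sliceDisc i) :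
    ∃ z : ℂ, ‖z‖ < 1 ∧ q = sliceEmb i z := by
  obtain ⟨hball, x, y, rfl⟩ := hq
  have h : pt i.1 x y = sliceEmb i ⟨x, y⟩ := (sliceEmb_apply i ⟨x, y⟩).symm
  exact ⟨⟨x, y⟩, mem_ball_zero_iff.mp ((sliceEmb_mem_unitBall_iff i _).mp (h ▸ hball)), h⟩

theorem sliceEmb_mem_sliceDisc {z : ℂ} (hz : ‖z‖ < 1) : sliceEmb i z ∈ sliceDisc i :=
  ⟨(sliceEmb_mem_unitBall_iff i z).mpr (mem_ball_zero_iff.mpr hz), z.re, z.im, sliceEmb_apply i z⟩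

theorem pseudoHyp_sliceEmb (z w : ℂ) :
    pseudoHyp (sliceEmb i z) (sliceEmb i w) = ‖z - w‖ / ‖1 - z * star w‖ := by
  rw [pseudoHyp, star_sliceEmb, ← map_mul, ← map_one (sliceEmb i), ← map_sub, ← map_sub,
    norm_sliceEmb, norm_sliceEmb]

/-- The `ℂ_i`-component of a quaternion in the decomposition `ℍ = ℂ_i ⊕ ℂ_i j` with `j ⊥ 1, i`,
read in `ℂ`. It is linear for the left multiplication by `ℂ_i`. -/
noncomputable def sliceCoord : ℍ[ℝ] →L[ℝ] ℂ :=
  Complex.equivRealProdCLM.symm.toContinuousLinearMap.comp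
    (reL.prod (-reL.comp (ContinuousLinearMap.mul ℝ ℍ[ℝ] i.1)))

theorem re_sliceCoord (q : ℍ[ℝ]) : (sliceCoord i q).re = q.re := rfl

theorem im_sliceCoord (q : ℍ[ℝ]) : (sliceCoord i q).im = -(i.1 * q).re := rfl

theorem sliceCoord_unit_mul (q : ℍ[ℝ]) : sliceCoord i (i.1 * q) = Complex.I * sliceCoord i q := by
  apply Complex.ext
  · simp [re_sliceCoord, im_sliceCoord]
  · rw [im_sliceCoord, ← mul_assoc, unit_mul_self]
    simp [re_sliceCoord]

theorem sliceEmb_eq_re_add_im_mul (z : ℂ) : sliceEmb i z = z.re • 1 + z.im • i.1 := by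
  simp [sliceEmb, Complex.liftAux_apply, Algebra.algebraMap_eq_smul_one]

theorem sliceCoord_sliceEmb_mul (c : ℂ) (q : ℍ[ℝ]) :
    sliceCoord i (sliceEmb i c * q) = c * sliceCoord i q := by
  rw [sliceEmb_eq_re_add_im_mul, add_mul, smul_mul_assoc, smul_mul_assoc, one_mul, map_add,
    map_smul, map_smul, sliceCoord_unit_mul]
  nth_rewrite 3 [← Complex.re_add_im c]
  simp only [Complex.real_smul]
  ring

theorem sliceCoord_sliceEmb (z : ℂ) : sliceCoord i (sliceEmb i z) = z := by
  have h : sliceCoord i 1 = 1 := by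
    apply Complex.ext <;> simp [re_sliceCoord, im_sliceCoord, i.2.1]
  rw [← mul_one (sliceEmb i z), sliceCoord_sliceEmb_mul, h, mul_one]

theorem sliceCoord_pt (x y : ℝ) : sliceCoord i (pt i.1 x y) = ⟨x, y⟩ := by
  rw [← sliceCoord_sliceEmb i ⟨x, y⟩, sliceEmb_apply]

theorem eq_of_forall_sliceCoord_mul_eq {x y : ℍ[ℝ]}
    (h : ∀ p, sliceCoord i (x * p) = sliceCoord i (y * p)) : x = y := by
  have hre := congrArg Complex.re (h (star (x - y)))
  rw [re_sliceCoord, re_sliceCoord, ← sub_eq_zero, ← Quaternion.re_sub, ← sub_mul,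
    Quaternion.self_mul_star, Quaternion.re_coe, Quaternion.normSq_eq_zero] at hre
  exact sub_eq_zero.mp hre

end Slice

section SliceHolomorphic

variable {i : ImagUnit} {g : ℂ → ℍ[ℝ]}

/-- Quaternion valued functions on the unit disc of `ℂ` that are holomorphic for the complex
structure given by left multiplication by `i`: the restrictions of left slice hyperholomorphic
functions to the slice disc `𝔻_i`. -/
def IsSliceHolomorphic (i : ImagUnit) (g : ℂ → ℍ[ℝ]) : Prop :=
  ∀ z ∈ ball (0 : ℂ) 1, DifferentiableAt ℝ g z ∧ fderiv ℝ g z Complex.I = i.1 * fderiv ℝ g z 1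

theorem isSliceHolomorphic_sliceEmb_comp {h : ℂ → ℂ} (hh : DifferentiableOn ℂ h (ball 0 1)) :
    IsSliceHolomorphic i fun z => sliceEmb i (h z) := by
  intro z hz
  obtain ⟨hd, hI⟩ := differentiableAt_complex_iff_differentiableAt_real.mp
    (hh.differentiableAt (isOpen_ball.mem_nhds hz))
  have hcomp := (sliceEmb i).toLinearMap.toContinuousLinearMap.hasFDerivAt.comp z hd.hasFDerivAt
  have hder : HasFDerivAt (fun z => sliceEmb i (h z)) _ z := hcomp
  refine ⟨hder.differentiableAt, ?_⟩
  rw [hder.fderiv]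
  simp [hI, sliceEmb_I]

theorem IsSliceHolomorphic.differentiableOn_sliceCoord_mul (hg : IsSliceHolomorphic i g)
    (p : ℍ[ℝ]) : DifferentiableOn ℂ (fun z => sliceCoord i (g z * p)) (ball 0 1) := by
  intro z hz
  obtain ⟨hd, hI⟩ := hg z hz
  have hder := (sliceCoord i).hasFDerivAt.comp z (hd.hasFDerivAt.mul_const' p)
  refine DifferentiableAt.differentiableWithinAt
    (differentiableAt_complex_iff_differentiableAt_real.mpr ⟨hder.differentiableAt, ?_⟩)
  change fderiv ℝ (sliceCoord i ∘ fun z => g z * p) z Complex.I =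
    Complex.I • fderiv ℝ (sliceCoord i ∘ fun z => g z * p) z 1
  rw [hder.fderiv]
  simp [hI, mul_assoc, sliceCoord_unit_mul]

theorem IsSliceHolomorphic.integral_star_discKernel_mul {α : ℝ} (hα : -1 < α)
    (hg : IsSliceHolomorphic i g) (hint : Integrable g (discMeasure α)) {w : ℂ} (hw : ‖w‖ < 1) :
    ∫ z, star (sliceEmb i (discKernel α w z)) * g z ∂discMeasure α = g w := by
  have hintK : Integrable (fun z => star (sliceEmb i (discKernel α w z)) * g z)
      (discMeasure α) := by
    refine hint.bdd_mul (c := (1 - ‖w‖) ^ (-(α + 2))) ?_ ?_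
    · exact (continuous_star.comp (sliceEmb i).toLinearMap.continuous_of_finiteDimensional
        ).comp_aestronglyMeasurable (measurable_discKernel α w).aestronglyMeasurable
    · simpa only [norm_star, norm_sliceEmb] using ae_norm_discKernel_le hα hw
  refine eq_of_forall_sliceCoord_mul_eq i fun p => ?_
  have hcoord := (sliceCoord i).integral_comp_comm (hintK.mul_const p)
  rw [← integral_mul_const_of_integrable hintK, ← hcoord]
  simp_rw [mul_assoc, star_sliceEmb, sliceCoord_sliceEmb_mul]
  exact integral_star_discKernel_smul hα hw (hg.differentiableOn_sliceCoord_mul p)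
    ((sliceCoord i).integrable_comp (hint.mul_const p))

end SliceHolomorphic

section Stem

variable {f : ℍ[ℝ] → ℍ[ℝ]} {a b : ℝ × ℝ → ℍ[ℝ]}

/-- Stem functions on the unit disc: `a` is even and `b` is odd in the second variable, and they
satisfy the Cauchy-Riemann equations. -/
structure IsStem (a b : ℝ × ℝ → ℍ[ℝ]) : Prop where
  even : ∀ x y : ℝ, x ^ 2 + y ^ 2 < 1 → a (x, -y) = a (x, y)
  odd : ∀ x y : ℝ, x ^ 2 + y ^ 2 < 1 → b (x, -y) = -b (x, y)
  differentiableAt_left : ∀ x y : ℝ, x ^ 2 + y ^ 2 < 1 → DifferentiableAt ℝ a (x, y)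
  differentiableAt_right : ∀ x y : ℝ, x ^ 2 + y ^ 2 < 1 → DifferentiableAt ℝ b (x, y)
  fderiv_left_fst : ∀ x y : ℝ, x ^ 2 + y ^ 2 < 1 →
    fderiv ℝ a (x, y) (1, 0) = fderiv ℝ b (x, y) (0, 1)
  fderiv_right_fst : ∀ x y : ℝ, x ^ 2 + y ^ 2 < 1 →
    fderiv ℝ b (x, y) (1, 0) = -fderiv ℝ a (x, y) (0, 1)

theorem re_sq_add_norm_im_sq_lt_one {q : ℍ[ℝ]} (hq : q ∈ unitBall) :
    q.re ^ 2 + ‖q.im‖ ^ 2 < 1 := by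
  rw [← normSq_eq_re_im, sq_lt_one_iff₀ (norm_nonneg _)]
  exact mem_ball_zero_iff.mp hq

theorem exists_pt_re_norm_im_eq (i : ImagUnit) (q : ℍ[ℝ]) :
    ∃ k : ImagUnit, pt k.1 q.re ‖q.im‖ = q := by
  rcases eq_or_ne q.im 0 with h | h
  · refine ⟨i, ?_⟩
    rw [h, norm_zero, pt, Quaternion.coe_zero, mul_zero, ← h]
    exact Quaternion.re_add_im q
  · refine ⟨⟨unitOf q, ?_, ?_⟩, ?_⟩
    · rw [unitOf, Quaternion.mul_coe_eq_smul]
      simp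
    · rw [unitOf, norm_mul, Quaternion.norm_coe, norm_inv, norm_norm,
        mul_inv_cancel₀ (norm_ne_zero_iff.mpr h)]
    · rw [pt, unitOf_mul_norm]
      exact Quaternion.re_add_im q

theorem IsStem.right_eq_zero (hab : IsStem a b) {x : ℝ} (hx : x ^ 2 < 1) : b (x, 0) = 0 := by
  refine eq_zero_of_eq_neg ?_
  simpa only [neg_zero] using hab.odd x 0 (by simpa using hx)

theorem IsStem.eq_add_unitOf_mul (hab : IsStem a b)
    (hf : ∀ (k : ImagUnit) (x y : ℝ), x ^ 2 + y ^ 2 < 1 →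
      f (pt k.1 x y) = a (x, y) + k.1 * b (x, y)) (i : ImagUnit) {q : ℍ[ℝ]} (hq : q ∈ unitBall) :
    f q = a (q.re, ‖q.im‖) + unitOf q * b (q.re, ‖q.im‖) := by
  have hlt := re_sq_add_norm_im_sq_lt_one hq
  obtain ⟨k, hk⟩ := exists_pt_re_norm_im_eq i q
  have hfq := hf k _ _ hlt
  rw [hk] at hfq
  rw [hfq]
  rcases eq_or_ne q.im 0 with h | h
  · rw [h, norm_zero] at hlt ⊢
    rw [hab.right_eq_zero (by simpa using hlt), mul_zero, mul_zero]
  · have him : k.1 * (‖q.im‖ : ℍ[ℝ]) = unitOf q * (‖q.im‖ : ℍ[ℝ]) := by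
      rw [unitOf_mul_norm, Quaternion.mul_coe_eq_smul, ← pt_im k q.re, hk]
    have hne : (‖q.im‖ : ℍ[ℝ]) ≠ 0 := by
      rwa [← norm_ne_zero_iff, Quaternion.norm_coe, norm_norm, norm_ne_zero_iff]
    rw [mul_right_cancel₀ hne him]

theorem isLeftSliceHyperholomorphicOn_unitBall_iff (i : ImagUnit) :
    IsLeftSliceHyperholomorphicOn f unitBall ↔ ∃ a b, IsStem a b ∧
      ∀ (k : ImagUnit) (x y : ℝ), x ^ 2 + y ^ 2 < 1 →
        f (pt k.1 x y) = a (x, y) + k.1 * b (x, y) := by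
  constructor
  · rintro ⟨-, a, b, hab⟩
    simp only [pt_mem_unitBall] at hab
    refine ⟨a, b, ⟨?_, ?_, ?_, ?_, ?_, ?_⟩, fun k x y h => (hab k x y h).1⟩
    all_goals
      intro x y h
      obtain ⟨-, heven, hodd, hda, hdb, hCR, hCR'⟩ := hab i x y h
      assumption
  · rintro ⟨a, b, hab, hf⟩
    refine ⟨fun q hq => ?_, a, b, fun k x y h => ?_⟩
    · have hd := differentiableAt_stem (a := a) (b := b) (fun x y h =>
        ⟨hab.even x y h, hab.odd x y h, hab.differentiableAt_left x y h,
          hab.differentiableAt_right x y h⟩) hq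
      refine (hd.congr_of_eventuallyEq ?_).differentiableWithinAt
      filter_upwards [isOpen_ball.mem_nhds hq] with x hx
      exact hab.eq_add_unitOf_mul hf i hx
    · rw [pt_mem_unitBall] at h
      exact ⟨hf k x y h, hab.even x y h, hab.odd x y h, hab.differentiableAt_left x y h,
        hab.differentiableAt_right x y h, hab.fderiv_left_fst x y h, hab.fderiv_right_fst x y h⟩

theorem re_sq_add_im_sq_lt_one_iff {z : ℂ} : z.re ^ 2 + z.im ^ 2 < 1 ↔ z ∈ ball (0 : ℂ) 1 := by
  rw [mem_ball_zero_iff, ← sq_lt_one_iff₀ (norm_nonneg z), Complex.sq_norm, Complex.normSq_apply,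
    sq, sq]

theorem IsLeftSliceHyperholomorphicOn.isSliceHolomorphic_restr (i : ImagUnit)
    (hf : IsLeftSliceHyperholomorphicOn f unitBall) : IsSliceHolomorphic i (restr i f) := by
  obtain ⟨a, b, hab, hf⟩ := (isLeftSliceHyperholomorphicOn_unitBall_iff i).mp hf
  intro z hz
  have hlt := re_sq_add_im_sq_lt_one_iff.mpr hz
  set e : ℂ →L[ℝ] ℝ × ℝ := Complex.equivRealProdCLM.toContinuousLinearMap
  have ha := (hab.differentiableAt_left _ _ hlt).hasFDerivAt.comp z
    (f := fun z : ℂ => (z.re, z.im)) e.hasFDerivAt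
  have hb := (hab.differentiableAt_right _ _ hlt).hasFDerivAt.comp z
    (f := fun z : ℂ => (z.re, z.im)) e.hasFDerivAt
  have hder := (ha.add (hb.const_mul i.1)).congr_of_eventuallyEq (f₁ := restr i f) (by
    filter_upwards [isOpen_ball.mem_nhds hz] with u hu
    exact hf i u.re u.im (re_sq_add_im_sq_lt_one_iff.mpr hu))
  refine ⟨hder.differentiableAt, ?_⟩
  have he1 : e 1 = (1, 0) := rfl
  have heI : e Complex.I = (0, 1) := rfl
  simp only [hder.fderiv, _root_.add_apply, _root_.smul_apply, ContinuousLinearMap.comp_apply,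
    he1, heI, hab.fderiv_left_fst _ _ hlt, hab.fderiv_right_fst _ _ hlt, smul_eq_mul, mul_add,
    mul_neg, ← mul_assoc, unit_mul_self]
  simp [add_comm]

theorem IsLeftSliceHyperholomorphicOn.eqOn_zero_of_restr_eqOn_zero {i : ImagUnit}
    (hf : IsLeftSliceHyperholomorphicOn f unitBall)
    (h0 : ∀ z ∈ ball (0 : ℂ) 1, restr i f z = 0) : ∀ q ∈ unitBall, f q = 0 := by
  obtain ⟨a, b, hab, hf⟩ := (isLeftSliceHyperholomorphicOn_unitBall_iff i).mp hf
  intro q hq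
  have hlt := re_sq_add_norm_im_sq_lt_one hq
  have hslice : ∀ y : ℝ, q.re ^ 2 + y ^ 2 < 1 → a (q.re, y) + i.1 * b (q.re, y) = 0 := by
    intro y hy
    rw [← hf i _ _ hy]
    exact h0 ⟨q.re, y⟩ (re_sq_add_im_sq_lt_one_iff.mp hy)
  have hplus := hslice _ hlt
  have hminus := hslice (-‖q.im‖) (by simpa using hlt)
  rw [hab.even _ _ hlt, hab.odd _ _ hlt, mul_neg] at hminus
  have hib : i.1 * b (q.re, ‖q.im‖) = 0 := eq_zero_of_eq_neg (by
    rw [← add_right_inj (a (q.re, ‖q.im‖)), hplus, hminus])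
  have hi : i.1 ≠ 0 := norm_ne_zero_iff.mp (by rw [i.2.2]; exact one_ne_zero)
  have hb : b (q.re, ‖q.im‖) = 0 := (mul_eq_zero.mp hib).resolve_left hi
  have ha : a (q.re, ‖q.im‖) = 0 := by rwa [hib, add_zero] at hplus
  rw [hab.eq_add_unitOf_mul hf i hq, ha, hb, mul_zero, add_zero]

end Stem

section Extension

variable {i : ImagUnit} {g : ℂ → ℍ[ℝ]}

theorem unitOf_pt (k : ImagUnit) (x y : ℝ) : unitOf (pt k.1 x y) = Real.sign y • k.1 := by
  rw [unitOf, norm_pt_im, pt_im, Quaternion.mul_coe_eq_smul, smul_smul]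
  congr 1
  rcases lt_trichotomy y 0 with h | rfl | h
  · rw [Real.sign_of_neg h, abs_of_neg h, inv_neg, neg_mul, inv_mul_cancel₀ h.ne]
  · simp
  · rw [Real.sign_of_pos h, abs_of_pos h, inv_mul_cancel₀ h.ne']

/-- The even component of the stem function of the slice hyperholomorphic extension of `g`. -/
noncomputable def stemEven (g : ℂ → ℍ[ℝ]) (p : ℝ × ℝ) : ℍ[ℝ] :=
  (1 / 2 : ℝ) • (g ⟨p.1, p.2⟩ + g ⟨p.1, -p.2⟩)

/-- The odd component of the stem function of the slice hyperholomorphic extension of `g`. -/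
noncomputable def stemOdd (i : ImagUnit) (g : ℂ → ℍ[ℝ]) (p : ℝ × ℝ) : ℍ[ℝ] :=
  (1 / 2 : ℝ) • (i.1 * (g ⟨p.1, -p.2⟩ - g ⟨p.1, p.2⟩))

theorem stemEven_neg (g : ℂ → ℍ[ℝ]) (x y : ℝ) : stemEven g (x, -y) = stemEven g (x, y) := by
  simp [stemEven, add_comm]

theorem stemOdd_neg (i : ImagUnit) (g : ℂ → ℍ[ℝ]) (x y : ℝ) :
    stemOdd i g (x, -y) = -stemOdd i g (x, y) := by
  rw [stemOdd, stemOdd, ← smul_neg, ← mul_neg, neg_sub, neg_neg]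

theorem stemEven_add_mul_stemOdd (i : ImagUnit) (g : ℂ → ℍ[ℝ]) (x y : ℝ) :
    stemEven g (x, y) + i.1 * stemOdd i g (x, y) = g ⟨x, y⟩ := by
  rw [stemEven, stemOdd, mul_smul_comm, ← mul_assoc, unit_mul_self, ← smul_add, neg_one_mul,
    neg_sub, add_add_sub_cancel, ← two_smul ℝ, smul_smul]
  norm_num

/-- The left slice hyperholomorphic extension to `𝔻`, by the representation formula, of a function
on the disc of `ℂ ≅ ℂ_i`; it vanishes outside `𝔻`. -/
noncomputable def sliceExt (i : ImagUnit) (g : ℂ → ℍ[ℝ]) : ℍ[ℝ] → ℍ[ℝ] := extL i (g ∘ sliceCoord i)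

theorem extL_eq_sliceExt_restr (i : ImagUnit) (f : ℍ[ℝ] → ℍ[ℝ]) :
    extL i f = sliceExt i (restr i f) := by
  funext q
  simp only [sliceExt, extL, Function.comp_apply, sliceCoord_pt, restr]

theorem sliceExt_apply_of_mem (i : ImagUnit) (g : ℂ → ℍ[ℝ]) {q : ℍ[ℝ]} (hq : q ∈ unitBall) :
    sliceExt i g q = stemEven g (q.re, ‖q.im‖) + unitOf q * stemOdd i g (q.re, ‖q.im‖) := by
  rw [sliceExt, extL, if_pos hq, Function.comp_apply, Function.comp_apply, sliceCoord_pt,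
    sliceCoord_pt, stemEven, stemOdd, mul_assoc, mul_assoc, Quaternion.coe_mul_eq_smul,
    Quaternion.coe_mul_eq_smul, mul_smul_comm, ← smul_add, ← smul_add]
  noncomm_ring

theorem sliceExt_pt (i k : ImagUnit) (g : ℂ → ℍ[ℝ]) {x y : ℝ} (h : x ^ 2 + y ^ 2 < 1) :
    sliceExt i g (pt k.1 x y) = stemEven g (x, y) + k.1 * stemOdd i g (x, y) := by
  rw [sliceExt_apply_of_mem i g ((pt_mem_unitBall k x y).mpr h), unitOf_pt, norm_pt_im, pt_re]
  rcases lt_trichotomy y 0 with hy | rfl | hy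
  · rw [Real.sign_of_neg hy, abs_of_neg hy, stemEven_neg, stemOdd_neg]
    simp
  · simp [stemOdd]
  · rw [Real.sign_of_pos hy, abs_of_pos hy, one_smul]

theorem restr_sliceExt (i : ImagUnit) (g : ℂ → ℍ[ℝ]) {z : ℂ} (hz : z ∈ ball (0 : ℂ) 1) :
    restr i (sliceExt i g) z = g z := by
  rw [restr, sliceExt_pt i i g (re_sq_add_im_sq_lt_one_iff.mpr hz), stemEven_add_mul_stemOdd]

theorem hasFDerivAt_stemEven {x y : ℝ} (hd : DifferentiableAt ℝ g ⟨x, y⟩)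
    (hd' : DifferentiableAt ℝ g ⟨x, -y⟩) :
    HasFDerivAt (stemEven g) ((1 / 2 : ℝ) •
      ((fderiv ℝ g ⟨x, y⟩).comp (Complex.equivRealProdCLM.symm : ℝ × ℝ →L[ℝ] ℂ) +
        (fderiv ℝ g ⟨x, -y⟩).comp
          (Complex.equivRealProdCLM.symm.trans Complex.conjCLE : ℝ × ℝ →L[ℝ] ℂ))) (x, y) :=
  ((hd.hasFDerivAt.comp (x, y) (f := Complex.equivRealProdCLM.symm)
    (ContinuousLinearEquiv.hasFDerivAt _)).add
      (hd'.hasFDerivAt.comp (x, y) (f := Complex.equivRealProdCLM.symm.trans Complex.conjCLE)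
        (ContinuousLinearEquiv.hasFDerivAt _))).const_smul (1 / 2 : ℝ)

theorem hasFDerivAt_stemOdd (i : ImagUnit) {x y : ℝ} (hd : DifferentiableAt ℝ g ⟨x, y⟩)
    (hd' : DifferentiableAt ℝ g ⟨x, -y⟩) :
    HasFDerivAt (stemOdd i g) ((1 / 2 : ℝ) • i.1 •
      ((fderiv ℝ g ⟨x, -y⟩).comp
          (Complex.equivRealProdCLM.symm.trans Complex.conjCLE : ℝ × ℝ →L[ℝ] ℂ) -
        (fderiv ℝ g ⟨x, y⟩).comp (Complex.equivRealProdCLM.symm : ℝ × ℝ →L[ℝ] ℂ))) (x, y) :=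
  (((hd'.hasFDerivAt.comp (x, y) (f := Complex.equivRealProdCLM.symm.trans Complex.conjCLE)
    (ContinuousLinearEquiv.hasFDerivAt _)).sub
      (hd.hasFDerivAt.comp (x, y) (f := Complex.equivRealProdCLM.symm)
        (ContinuousLinearEquiv.hasFDerivAt _))).const_mul i.1).const_smul (1 / 2 : ℝ)

theorem IsSliceHolomorphic.isStem (hg : IsSliceHolomorphic i g) :
    IsStem (stemEven g) (stemOdd i g) := by
  have hmem : ∀ {x y : ℝ}, x ^ 2 + y ^ 2 < 1 → (⟨x, y⟩ : ℂ) ∈ ball (0 : ℂ) 1 := fun h =>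
    re_sq_add_im_sq_lt_one_iff.mp h
  have hmem' : ∀ {x y : ℝ}, x ^ 2 + y ^ 2 < 1 → (⟨x, -y⟩ : ℂ) ∈ ball (0 : ℂ) 1 := fun h =>
    hmem (by rwa [neg_sq])
  have hone : Complex.equivRealProdCLM.symm ((1 : ℝ), (0 : ℝ)) = 1 := rfl
  have hI : Complex.equivRealProdCLM.symm ((0 : ℝ), (1 : ℝ)) = Complex.I := rfl
  refine ⟨fun x y _ => stemEven_neg g x y, fun x y _ => stemOdd_neg i g x y,
    fun x y h => (hasFDerivAt_stemEven (hg _ (hmem h)).1 (hg _ (hmem' h)).1).differentiableAt,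
    fun x y h => (hasFDerivAt_stemOdd i (hg _ (hmem h)).1 (hg _ (hmem' h)).1).differentiableAt,
    fun x y h => ?_, fun x y h => ?_⟩
  all_goals
    obtain ⟨hd, hCR⟩ := hg _ (hmem h)
    obtain ⟨hd', hCR'⟩ := hg _ (hmem' h)
    simp only [(hasFDerivAt_stemEven hd hd').fderiv, (hasFDerivAt_stemOdd i hd hd').fderiv,
      _root_.smul_apply, _root_.add_apply, _root_.sub_apply, ContinuousLinearMap.comp_apply,
      ContinuousLinearEquiv.coe_coe, ContinuousLinearEquiv.trans_apply, Complex.conjCLE_apply,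
      hone, hI, map_one, Complex.conj_I, map_neg, hCR, hCR', smul_eq_mul, ← smul_neg]
  · rw [neg_sub_left, mul_neg, ← mul_add, ← mul_assoc, unit_mul_self, neg_one_mul, neg_neg]
  · rw [neg_add, neg_neg, mul_sub, neg_add_eq_sub]

theorem IsSliceHolomorphic.sliceExt_mem_bergmanSpace {α : ℝ} (hg : IsSliceHolomorphic i g)
    (hL : MemLp g 2 (discMeasure α)) : sliceExt i g ∈ bergmanSpace α i := by
  refine ⟨fun q hq => by rw [sliceExt, extL, if_neg hq],
    (isLeftSliceHyperholomorphicOn_unitBall_iff i).mpr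
      ⟨_, _, hg.isStem, fun k x y h => sliceExt_pt i k g h⟩, hL.ae_eq ?_⟩
  filter_upwards [ae_mem_ball_discMeasure α] with z hz
  exact (restr_sliceExt i g hz).symm

end Extension

section InnerProduct

variable {α : ℝ} {i : ImagUnit}

theorem restr_op_smul (c : ℍ[ℝ]) (f : bergmanSpace α i) (z : ℂ) :
    restr i (op c • f : bergmanSpace α i) z = restr i f z * c := rfl

theorem ext_restr {f g : bergmanSpace α i}
    (h : ∀ z ∈ ball (0 : ℂ) 1, restr i f z = restr i g z) : f = g := by
  refine sub_eq_zero.mp (Subtype.ext (funext fun q => ?_))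
  by_cases hq : q ∈ unitBall
  · exact (f - g).2.2.1.eqOn_zero_of_restr_eqOn_zero (fun z hz => sub_eq_zero.mpr (h z hz)) q hq
  · exact (f - g).2.1 q hq

theorem integrable_restr (hα : -1 < α) (f : bergmanSpace α i) :
    Integrable (restr i f) (discMeasure α) :=
  have := isProbabilityMeasure_discMeasure hα
  f.2.2.2.integrable one_le_two

theorem integrable_star_restr_mul_restr (f g : bergmanSpace α i) :
    Integrable (fun z => star (restr i f z) * restr i g z) (discMeasure α) :=
  f.2.2.2.star.integrable_mul g.2.2.2

theorem bInner_add_right (f g h : bergmanSpace α i) :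
    bInner f (g + h) = bInner f g + bInner f h := by
  rw [bInner, bInner, bInner, ← integral_add (integrable_star_restr_mul_restr f g)
    (integrable_star_restr_mul_restr f h)]
  exact integral_congr_ae (.of_forall fun z => mul_add _ _ _)

theorem bInner_smul_right (f g : bergmanSpace α i) (c : ℍ[ℝ]) :
    bInner f (op c • g) = bInner f g * c := by
  rw [bInner, bInner, ← integral_mul_const_of_integrable (integrable_star_restr_mul_restr f g)]
  exact integral_congr_ae (.of_forall fun z => (mul_assoc _ _ _).symm)

theorem bInner_sub_right (f g h : bergmanSpace α i) :
    bInner f (g - h) = bInner f g - bInner f h := by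
  rw [eq_sub_iff_add_eq, ← bInner_add_right, sub_add_cancel]

theorem star_bInner (f g : bergmanSpace α i) : star (bInner f g) = bInner g f := by
  let starMap : ℍ[ℝ] →ₗ[ℝ] ℍ[ℝ] := ⟨⟨star, star_add⟩, Quaternion.star_smul⟩
  have hcomm := starMap.toContinuousLinearMap.integral_comp_comm
    (integrable_star_restr_mul_restr f g)
  simpa [bInner, starMap] using hcomm.symm

theorem bInner_add_left (f g h : bergmanSpace α i) :
    bInner (f + g) h = bInner f h + bInner g h := by
  rw [← star_bInner, bInner_add_right, star_add, star_bInner, star_bInner]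

theorem bInner_sub_left (f g h : bergmanSpace α i) :
    bInner (f - g) h = bInner f h - bInner g h := by
  rw [← star_bInner, bInner_sub_right, star_sub, star_bInner, star_bInner]

theorem bInner_smul_left (f g : bergmanSpace α i) (c : ℍ[ℝ]) :
    bInner (op c • f) g = star c * bInner f g := by
  rw [← star_bInner, bInner_smul_right, star_mul, star_bInner]

theorem bNorm_nonneg (f : bergmanSpace α i) : 0 ≤ bNorm f := Real.sqrt_nonneg _

theorem bNorm_sq (f : bergmanSpace α i) : bNorm f ^ 2 = ∫ z, ‖restr i f z‖ ^ 2 ∂discMeasure α :=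
  Real.sq_sqrt (integral_nonneg fun _ => sq_nonneg _)

theorem bInner_self (f : bergmanSpace α i) : bInner f f = ((bNorm f ^ 2 : ℝ) : ℍ[ℝ]) := by
  have hcoe := (Algebra.linearMap ℝ ℍ[ℝ]).toContinuousLinearMap.integral_comp_comm
    (f.2.2.2.integrable_norm_pow two_ne_zero)
  rw [bNorm_sq, bInner]
  simp only [Quaternion.star_mul_self, Quaternion.normSq_eq_norm_mul_self, ← sq]
  exact hcoe

theorem norm_bInner_le (f g : bergmanSpace α i) : ‖bInner f g‖ ≤ bNorm f * bNorm g := by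
  have hHolder := integral_mul_norm_le_Lp_mul_Lq (μ := discMeasure α)
    Real.HolderConjugate.two_two (f := restr i f) (g := restr i g)
    (by simpa using f.2.2.2) (by simpa using g.2.2.2)
  simp only [Real.rpow_two, ← Real.sqrt_eq_rpow] at hHolder
  refine (norm_integral_le_integral_norm _).trans ?_
  simpa only [norm_mul, norm_star, bNorm] using hHolder

theorem bNorm_smul (f : bergmanSpace α i) (c : ℍ[ℝ]) : bNorm (op c • f) = bNorm f * ‖c‖ := by
  rw [← sq_eq_sq₀ (bNorm_nonneg _) (mul_nonneg (bNorm_nonneg _) (norm_nonneg _)), mul_pow,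
    bNorm_sq, bNorm_sq, ← integral_mul_const]
  simp only [restr_op_smul, norm_mul, mul_pow]

theorem restr_opJ (f : bergmanSpace α i) {z : ℂ} (hz : z ∈ ball (0 : ℂ) 1) :
    restr i (opJ α i f) z = i.1 * restr i f z := by
  change restr i (extL i fun q => i.1 * f.1 q) z = _
  rw [extL_eq_sliceExt_restr, restr_sliceExt i _ hz]
  rfl

theorem bInner_opJ_right (f g : bergmanSpace α i) :
    bInner f (opJ α i g) = -bInner (opJ α i f) g := by
  rw [bInner, bInner, ← integral_neg]
  refine integral_congr_ae ?_
  filter_upwards [ae_mem_ball_discMeasure α] with z hz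
  rw [restr_opJ f hz, restr_opJ g hz, star_mul, star_unit, mul_neg, neg_mul, neg_neg, mul_assoc]

/-- `f` takes its values on `𝔻_i` in `ℂ_i`, encoded as the commutation of these values with `i`. -/
def IsSliceValued (f : bergmanSpace α i) : Prop := opJ α i f = op i.1 • f

theorem commute_unit_sliceEmb (i : ImagUnit) (c : ℂ) : Commute i.1 (sliceEmb i c) := by
  rw [← sliceEmb_I]
  exact (Commute.all Complex.I c).map (sliceEmb i)

theorem isSliceValued_of_restr_eq {f : bergmanSpace α i} {h : ℂ → ℂ}
    (hf : ∀ z ∈ ball (0 : ℂ) 1, restr i f z = sliceEmb i (h z)) : IsSliceValued f := by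
  refine ext_restr fun z hz => ?_
  rw [restr_opJ f hz, restr_op_smul, hf z hz, (commute_unit_sliceEmb i (h z)).eq]

theorem IsSliceValued.smul_sliceEmb {f : bergmanSpace α i} (hf : IsSliceValued f) (c : ℂ) :
    IsSliceValued (op (sliceEmb i c) • f) := by
  rw [IsSliceValued, map_smul, show opJ α i f = op i.1 • f from hf, smul_smul, smul_smul, ← op_mul,
    ← op_mul,     (commute_unit_sliceEmb i c).eq]

theorem IsSliceValued.bInner_opJ_right {f : bergmanSpace α i} (hf : IsSliceValued f)
    (g : bergmanSpace α i) : bInner f (opJ α i g) = i.1 * bInner f g := by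
  rw [SliceBergman.bInner_opJ_right, show opJ α i f = op i.1 • f from hf, bInner_smul_left,
    star_unit, neg_mul, neg_neg]

end InnerProduct

section ReproducingKernel

variable {α : ℝ} {i : ImagUnit} {z w : ℂ}

theorem sliceExt_discKernel_mem_bergmanSpace (hα : -1 < α) (i : ImagUnit) (hw : ‖w‖ < 1) :
    sliceExt i (fun z => sliceEmb i (discKernel α w z)) ∈ bergmanSpace α i := by
  have := isProbabilityMeasure_discMeasure hα
  refine (isSliceHolomorphic_sliceEmb_comp fun u hu => (differentiableAt_discKernel α hw
    (mem_ball_zero_iff.mp hu)).differentiableWithinAt).sliceExt_mem_bergmanSpace ?_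
  refine MemLp.of_bound ?_ ((1 - ‖w‖) ^ (-(α + 2))) ?_
  · exact (sliceEmb i).toLinearMap.continuous_of_finiteDimensional.comp_aestronglyMeasurable
      (measurable_discKernel α w).aestronglyMeasurable
  · simpa only [norm_sliceEmb] using ae_norm_discKernel_le hα hw

theorem bInner_sliceExt_discKernel (hα : -1 < α) (hw : ‖w‖ < 1) (f : bergmanSpace α i) :
    bInner ⟨_, sliceExt_discKernel_mem_bergmanSpace hα i hw⟩ f = restr i f w := by
  refine Eq.trans (integral_congr_ae ?_)
    ((f.2.2.1.isSliceHolomorphic_restr i).integral_star_discKernel_mul hα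
      (integrable_restr hα f) hw)
  filter_upwards [ae_mem_ball_discMeasure α] with z hz
  simp only [restr_sliceExt i _ hz]

theorem bInner_kernel (hα : -1 < α) (hw : ‖w‖ < 1) (f : bergmanSpace α i) :
    bInner (kernel α i (sliceEmb i w)) f = restr i f w := by
  rw [restr_apply]
  exact Classical.epsilon_spec (p := fun K : bergmanSpace α i => ∀ f : bergmanSpace α i,
    bInner K f = f.1 (sliceEmb i w)) ⟨_, fun f => by
      rw [bInner_sliceExt_discKernel hα hw, restr_apply]⟩ f

theorem restr_kernel (hα : -1 < α) (i : ImagUnit) (hw : ‖w‖ < 1) (hz : ‖z‖ < 1) :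
    restr i (kernel α i (sliceEmb i w)) z = sliceEmb i (discKernel α w z) := by
  have heq : kernel α i (sliceEmb i w) =
      ⟨_, sliceExt_discKernel_mem_bergmanSpace hα i hw⟩ := by
    refine ext_restr fun u hu => ?_
    have hu' := mem_ball_zero_iff.mp hu
    rw [← bInner_kernel hα hu', ← bInner_kernel hα hu', ← star_bInner, bInner_kernel hα hw,
      ← bInner_sliceExt_discKernel hα hw, star_bInner]
  rw [heq]
  exact restr_sliceExt i _ (mem_ball_zero_iff.mpr hz)

theorem eq_zero_of_bNorm_eq_zero (hα : -1 < α) {f : bergmanSpace α i} (h : bNorm f = 0) :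
    f = 0 := by
  refine ext_restr fun z hz => ?_
  have hle := norm_bInner_le (kernel α i (sliceEmb i z)) f
  rw [bInner_kernel hα (mem_ball_zero_iff.mp hz), h, mul_zero] at hle
  exact norm_le_zero_iff.mp hle

theorem bNorm_kernel_sq (hα : -1 < α) (i : ImagUnit) (hw : ‖w‖ < 1) :
    bNorm (kernel α i (sliceEmb i w)) ^ 2 = (1 - ‖w‖ ^ 2) ^ (-(α + 2)) := by
  apply Quaternion.coe_injective
  rw [← bInner_self, bInner_kernel hα hw, restr_kernel hα i hw hw, discKernel_self α hw,
    sliceEmb_ofReal]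

theorem normKernel_eq (hα : -1 < α) (i : ImagUnit) (hw : ‖w‖ < 1) :
    normKernel α i (sliceEmb i w) =
      op ((√((1 - ‖w‖ ^ 2) ^ (α + 2)) : ℝ) : ℍ[ℝ]) • kernel α i (sliceEmb i w) := by
  have hself := restr_kernel hα i hw hw
  rw [restr_apply, discKernel_self α hw, sliceEmb_ofReal] at hself
  rw [normKernel, hself, Quaternion.re_coe, Real.rpow_neg (one_sub_norm_sq_pos hw).le,
    Real.sqrt_inv, inv_inv]

theorem bNorm_normKernel (hα : -1 < α) (i : ImagUnit) (hw : ‖w‖ < 1) :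
    bNorm (normKernel α i (sliceEmb i w)) = 1 := by
  have h := one_sub_norm_sq_pos hw
  rw [← sq_eq_sq₀ (bNorm_nonneg _) zero_le_one, normKernel_eq hα i hw, bNorm_smul, mul_pow,
    bNorm_kernel_sq hα i hw, Quaternion.norm_coe, Real.norm_eq_abs, sq_abs,
    Real.sq_sqrt (Real.rpow_nonneg h.le _), ← Real.rpow_add h, neg_add_cancel, Real.rpow_zero,
    one_pow]

theorem isSliceValued_normKernel (hα : -1 < α) (i : ImagUnit) (hw : ‖w‖ < 1) :
    IsSliceValued (normKernel α i (sliceEmb i w)) := by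
  rw [normKernel_eq hα i hw, ← sliceEmb_ofReal i]
  exact (isSliceValued_of_restr_eq fun z hz =>
    restr_kernel hα i hw (mem_ball_zero_iff.mp hz)).smul_sliceEmb _

theorem pseudoHyp_sliceEmb_eq_norm_discInvolution (i : ImagUnit) (z w : ℂ) :
    pseudoHyp (sliceEmb i z) (sliceEmb i w) = ‖discInvolution w z‖ := by
  rw [pseudoHyp_sliceEmb, discInvolution, norm_div, norm_sub_rev, mul_comm z]

theorem pseudoHyp_mem_Ico_of_mem_sliceDisc {p q : ℍ[ℝ]} (hp : p ∈ sliceDisc i)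
    (hq : q ∈ sliceDisc i) : pseudoHyp p q ∈ Ico 0 1 := by
  obtain ⟨z, hz, rfl⟩ := exists_sliceEmb_of_mem_sliceDisc i hp
  obtain ⟨w, hw, rfl⟩ := exists_sliceEmb_of_mem_sliceDisc i hq
  rw [pseudoHyp_sliceEmb_eq_norm_discInvolution]
  exact ⟨norm_nonneg _, mem_ball_zero_iff.mp (mapsTo_discInvolution hw (mem_ball_zero_iff.mpr hz))⟩

theorem bInner_normKernel (hα : -1 < α) (i : ImagUnit) (hz : ‖z‖ < 1) (hw : ‖w‖ < 1) :
    bInner (normKernel α i (sliceEmb i z)) (normKernel α i (sliceEmb i w)) =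
      sliceEmb i ((√((1 - ‖z‖ ^ 2) ^ (α + 2)) : ℝ) * discKernel α w z *
        (√((1 - ‖w‖ ^ 2) ^ (α + 2)) : ℝ)) := by
  rw [normKernel_eq hα i hz, normKernel_eq hα i hw, bInner_smul_right, bInner_smul_left,
    bInner_kernel hα hz, restr_kernel hα i hw hz, Quaternion.star_coe, map_mul, map_mul,
    sliceEmb_ofReal, sliceEmb_ofReal]

theorem norm_sq_bInner_normKernel (hα : -1 < α) (i : ImagUnit) (hz : ‖z‖ < 1) (hw : ‖w‖ < 1) :
    ‖bInner (normKernel α i (sliceEmb i z)) (normKernel α i (sliceEmb i w))‖ ^ 2 =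
      (1 - pseudoHyp (sliceEmb i z) (sliceEmb i w) ^ 2) ^ (α + 2) := by
  have hz' := one_sub_norm_sq_pos hz
  have hw' := one_sub_norm_sq_pos hw
  have hne : 0 < ‖1 - star w * z‖ := norm_pos_iff.mpr (one_sub_star_mul_ne_zero hw hz)
  rw [bInner_normKernel hα i hz hw, norm_sliceEmb, pseudoHyp_sliceEmb_eq_norm_discInvolution,
    norm_mul, norm_mul, mul_pow, mul_pow, Complex.norm_real, Complex.norm_real, Real.norm_eq_abs,
    Real.norm_eq_abs, sq_abs, sq_abs, Real.sq_sqrt (Real.rpow_nonneg hz'.le _),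
    Real.sq_sqrt (Real.rpow_nonneg hw'.le _), norm_discKernel, one_sub_norm_sq_discInvolution hw hz,
    Real.div_rpow (by positivity) (by positivity), Real.mul_rpow hw'.le hz'.le,
    Real.rpow_neg hne.le, ← Real.rpow_pow_comm hne.le]
  field_simp

end ReproducingKernel

section BoundedOperator

variable {α : ℝ} {i : ImagUnit} {T : bergmanSpace α i →ₗ[(ℍ[ℝ])ᵐᵒᵖ] bergmanSpace α i}

theorem re_bInner_self (f : bergmanSpace α i) : (bInner f f).re = bNorm f ^ 2 := by
  rw [bInner_self, Quaternion.re_coe]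

theorem re_bInner_comm (f g : bergmanSpace α i) : (bInner f g).re = (bInner g f).re := by
  rw [← star_bInner, Quaternion.re_star]

theorem bNorm_add_sq (f g : bergmanSpace α i) :
    bNorm (f + g) ^ 2 = bNorm f ^ 2 + 2 * (bInner f g).re + bNorm g ^ 2 := by
  simp only [← re_bInner_self, bInner_add_left, bInner_add_right, Quaternion.re_add,
    re_bInner_comm g f]
  ring

theorem bNorm_sub_sq (f g : bergmanSpace α i) :
    bNorm (f - g) ^ 2 = bNorm f ^ 2 - 2 * (bInner f g).re + bNorm g ^ 2 := by
  simp only [← re_bInner_self, bInner_sub_left, bInner_sub_right, Quaternion.re_sub,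
    re_bInner_comm g f]
  ring

theorem opNorm_nonneg (T : bergmanSpace α i →ₗ[(ℍ[ℝ])ᵐᵒᵖ] bergmanSpace α i) : 0 ≤ opNorm T :=
  Real.sSup_nonneg (by rintro r ⟨f, -, rfl⟩; exact bNorm_nonneg _)

theorem bNorm_apply_le (hα : -1 < α) (hT : IsBoundedOp T) (f : bergmanSpace α i) :
    bNorm (T f) ≤ opNorm T * bNorm f := by
  rcases (bNorm_nonneg f).eq_or_lt with h | hpos
  · have hTf : T f = op (0 : ℍ[ℝ]) • f := by
      rw [eq_zero_of_bNorm_eq_zero hα h.symm, map_zero, smul_zero]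
    rw [hTf, bNorm_smul, ← h, zero_mul, mul_zero]
  · have hnorm : ‖(((bNorm f)⁻¹ : ℝ) : ℍ[ℝ])‖ = (bNorm f)⁻¹ := by
      rw [Quaternion.norm_coe, Real.norm_of_nonneg (inv_nonneg.mpr hpos.le)]
    have hle : bNorm (T (op (((bNorm f)⁻¹ : ℝ) : ℍ[ℝ]) • f)) ≤ opNorm T :=
      le_csSup hT ⟨_, by rw [bNorm_smul, hnorm, mul_inv_cancel₀ hpos.ne'], rfl⟩
    rwa [map_smul, bNorm_smul, hnorm, ← div_eq_mul_inv, div_le_iff₀ hpos] at hle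

theorem norm_bInner_apply_le (hα : -1 < α) (hT : IsBoundedOp T) (f g : bergmanSpace α i) :
    ‖bInner f (T g)‖ ≤ opNorm T * (bNorm f * bNorm g) :=
  calc ‖bInner f (T g)‖ ≤ bNorm f * bNorm (T g) := norm_bInner_le _ _
    _ ≤ bNorm f * (opNorm T * bNorm g) :=
      mul_le_mul_of_nonneg_left (bNorm_apply_le hα hT g) (bNorm_nonneg f)
    _ = opNorm T * (bNorm f * bNorm g) := by ring

theorem bNorm_sub_mul_bNorm_add {u v : bergmanSpace α i} (hu : bNorm u = 1) (hv : bNorm v = 1) :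
    bNorm (u - v) * bNorm (u + v) = 2 * √(1 - (bInner u v).re ^ 2) := by
  rw [← Real.sqrt_sq (mul_nonneg (bNorm_nonneg (u - v)) (bNorm_nonneg (u + v))), mul_pow,
    bNorm_sub_sq, bNorm_add_sq, hu, hv, ← Real.sqrt_sq zero_le_two, ← Real.sqrt_mul (by positivity),
    Real.sqrt_sq zero_le_two]
  congr 1
  ring

theorem norm_bInner_apply_sub_le (hα : -1 < α) (hT : IsBoundedOp T) {u v : bergmanSpace α i}
    (hu : bNorm u = 1) (hv : bNorm v = 1) :
    ‖bInner u (T u) - bInner v (T v)‖ ≤ 2 * opNorm T * √(1 - (bInner u v).re ^ 2) := by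
  have hpolar : (2 : ℝ) • (bInner u (T u) - bInner v (T v)) =
      bInner (u - v) (T (u + v)) + bInner (u + v) (T (u - v)) := by
    rw [map_add, map_sub, bInner_sub_left, bInner_add_left, bInner_sub_right, bInner_sub_right,
      bInner_add_right, bInner_add_right, two_smul]
    abel
  have hsum := norm_add_le_of_le (norm_bInner_apply_le hα hT (u - v) (u + v))
    (norm_bInner_apply_le hα hT (u + v) (u - v))
  rw [← hpolar, norm_smul, Real.norm_ofNat, mul_comm (bNorm (u + v)),
    bNorm_sub_mul_bNorm_add hu hv] at hsum
  linarith

theorem commute_bInner_apply_sliceEmb (hT : T ∘ₗ opJ α i = opJ α i ∘ₗ T) {f : bergmanSpace α i}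
    (hf : IsSliceValued f) (c : ℂ) : Commute (bInner f (T f)) (sliceEmb i c) := by
  have hunit : Commute (bInner f (T f)) i.1 := by
    have hTJ : T (opJ α i f) = opJ α i (T f) := LinearMap.congr_fun hT f
    rw [show opJ α i f = op i.1 • f from hf, map_smul] at hTJ
    rw [Commute, SemiconjBy, ← bInner_smul_right, hTJ, hf.bInner_opJ_right]
  rw [sliceEmb_eq_re_add_im_mul]
  exact ((Commute.one_right _).smul_right _).add_right (hunit.smul_right _)

theorem bInner_smul_apply_smul (hT : T ∘ₗ opJ α i = opJ α i ∘ₗ T) {f : bergmanSpace α i}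
    (hf : IsSliceValued f) {c : ℂ} (hc : ‖c‖ = 1) :
    bInner (op (sliceEmb i c) • f) (T (op (sliceEmb i c) • f)) = bInner f (T f) := by
  rw [map_smul, bInner_smul_right, bInner_smul_left, mul_assoc,
    (commute_bInner_apply_sliceEmb hT hf c).eq, ← mul_assoc, Quaternion.star_mul_self,
    Quaternion.normSq_eq_norm_mul_self, norm_sliceEmb, hc, mul_one, Quaternion.coe_one, one_mul]

theorem isBoundedOp_of_bNorm_apply_le {M : ℝ} (h : ∀ f, bNorm (T f) ≤ M * bNorm f) :
    IsBoundedOp T :=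
  ⟨M, by rintro r ⟨f, hf, rfl⟩; simpa [hf] using h f⟩

theorem opNorm_le_of_bNorm_apply_le {M : ℝ} (hM : 0 ≤ M) (h : ∀ f, bNorm (T f) ≤ M * bNorm f) :
    opNorm T ≤ M :=
  Real.sSup_le (by rintro r ⟨f, hf, rfl⟩; simpa [hf] using h f) hM

theorem bNorm_apply_le_of_cube_eq_smul (hsymm : ∀ f g, bInner (T f) g = bInner f (T g)) {s : ℝ}
    (hcube : ∀ f, T (T (T f)) = op (s : ℍ[ℝ]) • T f) (f : bergmanSpace α i) :
    bNorm (T f) ≤ √s * bNorm f := by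
  have hTT : bNorm (T (T f)) = √s * bNorm (T f) := by
    rw [← Real.sqrt_sq (bNorm_nonneg (T (T f))), ← re_bInner_self, hsymm, hcube, bInner_smul_right,
      bInner_self, ← Quaternion.coe_mul, Quaternion.re_coe, mul_comm,
      Real.sqrt_mul' _ (sq_nonneg _),
      Real.sqrt_sq (bNorm_nonneg _)]
  have hsq : bNorm (T f) ^ 2 ≤ bNorm f * bNorm (T (T f)) := by
    rw [← re_bInner_self, hsymm]
    exact ((le_abs_self _).trans (abs_re_le_norm _)).trans (norm_bInner_le _ _)
  rw [hTT] at hsq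
  rcases (bNorm_nonneg (T f)).eq_or_lt with h0 | hpos
  · rw [← h0]
    exact mul_nonneg (Real.sqrt_nonneg _) (bNorm_nonneg _)
  · nlinarith

end BoundedOperator

section RankOne

variable {α : ℝ} {i : ImagUnit} {u v : bergmanSpace α i}

/-- The operator `f ↦ u ⟨u, f⟩`, which for a unit vector `u` is the orthogonal projection onto its
span. -/
noncomputable def rankOne (u : bergmanSpace α i) :
    bergmanSpace α i →ₗ[(ℍ[ℝ])ᵐᵒᵖ] bergmanSpace α i where
  toFun f := op (bInner u f) • u
  map_add' f g := by rw [bInner_add_right, op_add, add_smul]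
  map_smul' c f := by
    rw [← op_unop c, bInner_smul_right, op_mul, mul_smul, RingHom.id_apply]

theorem rankOne_apply (u f : bergmanSpace α i) : rankOne u f = op (bInner u f) • u := rfl

theorem rankOne_apply_self (hu : bNorm u = 1) : rankOne u u = u := by
  rw [rankOne_apply, bInner_self, hu, one_pow, Quaternion.coe_one, op_one, one_smul]

theorem bInner_rankOne_left (u f g : bergmanSpace α i) :
    bInner (rankOne u f) g = bInner f (rankOne u g) := by
  rw [rankOne_apply, rankOne_apply, bInner_smul_left, bInner_smul_right, star_bInner]

theorem IsSliceValued.rankOne_comp_opJ (hu : IsSliceValued u) :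
    rankOne u ∘ₗ opJ α i = opJ α i ∘ₗ rankOne u := by
  ext1 f
  rw [LinearMap.comp_apply, LinearMap.comp_apply, rankOne_apply, rankOne_apply, map_smul,
    show opJ α i u = op i.1 • u from hu, hu.bInner_opJ_right, op_mul, mul_smul]

theorem rankOne_sub_rankOne_apply_apply (hu : bNorm u = 1) (hv : bNorm v = 1) {c : ℝ}
    (huv : bInner u v = (c : ℍ[ℝ])) :
    (rankOne u - rankOne v) ((rankOne u - rankOne v) u) = op ((1 - c ^ 2 : ℝ) : ℍ[ℝ]) • u := by
  have hvu : bInner v u = (c : ℍ[ℝ]) := by rw [← star_bInner, huv, Quaternion.star_coe]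
  have hTu : (rankOne u - rankOne v) u = u - op (c : ℍ[ℝ]) • v := by
    rw [LinearMap.sub_apply, rankOne_apply_self hu, rankOne_apply, hvu]
  have hTv : (rankOne u - rankOne v) v = op (c : ℍ[ℝ]) • u - v := by
    rw [LinearMap.sub_apply, rankOne_apply_self hv, rankOne_apply, huv]
  rw [hTu, map_sub, map_smul, hTu, hTv, smul_sub, sub_sub_sub_cancel_right, smul_smul, ← op_mul,
    ← Quaternion.coe_mul, ← sq, Quaternion.coe_sub, Quaternion.coe_one]
  exact ((sub_smul _ _ u).trans (congrArg (· - _) (one_smul _ u))).symm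

theorem rankOne_sub_rankOne_cube (hu : bNorm u = 1) (hv : bNorm v = 1) {c : ℝ}
    (huv : bInner u v = (c : ℍ[ℝ])) (f : bergmanSpace α i) :
    (rankOne u - rankOne v) ((rankOne u - rankOne v) ((rankOne u - rankOne v) f)) =
      op ((1 - c ^ 2 : ℝ) : ℍ[ℝ]) • (rankOne u - rankOne v) f := by
  have hvu : bInner v u = (c : ℍ[ℝ]) := by rw [← star_bInner, huv, Quaternion.star_coe]
  have hTTv : (rankOne u - rankOne v) ((rankOne u - rankOne v) v) =
      op ((1 - c ^ 2 : ℝ) : ℍ[ℝ]) • v := by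
    rw [← rankOne_sub_rankOne_apply_apply hv hu hvu, ← neg_sub (rankOne v), LinearMap.neg_apply,
      LinearMap.neg_apply, map_neg, neg_neg]
  have hcomm : ∀ (q : ℍ[ℝ]) (g : bergmanSpace α i), op q • op ((1 - c ^ 2 : ℝ) : ℍ[ℝ]) • g =
      op ((1 - c ^ 2 : ℝ) : ℍ[ℝ]) • op q • g := fun q g => by
    rw [smul_smul, smul_smul, ← op_mul, ← op_mul, Quaternion.coe_commutes _ q]
  rw [LinearMap.sub_apply _ _ f, rankOne_apply, rankOne_apply, map_sub, map_sub, map_smul, map_smul,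
    map_smul, map_smul, rankOne_sub_rankOne_apply_apply hu hv huv, hTTv, hcomm, hcomm, smul_sub]

theorem exists_mem_boundedCommJ_opNorm_le (hu : bNorm u = 1) (hv : bNorm v = 1)
    (hu' : IsSliceValued u) (hv' : IsSliceValued v) {c : ℝ} (huv : bInner u v = (c : ℍ[ℝ])) :
    ∃ T ∈ boundedCommJ α i, opNorm T ≤ √(1 - c ^ 2) ∧
      bInner u (T u) - bInner v (T v) = ((2 * (1 - c ^ 2) : ℝ) : ℍ[ℝ]) := by
  have hvu : bInner v u = (c : ℍ[ℝ]) := by rw [← star_bInner, huv, Quaternion.star_coe]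
  have hle := bNorm_apply_le_of_cube_eq_smul (T := rankOne u - rankOne v)
    (fun f g => by
      rw [LinearMap.sub_apply, LinearMap.sub_apply, bInner_sub_left, bInner_sub_right,
        bInner_rankOne_left, bInner_rankOne_left])
    (rankOne_sub_rankOne_cube hu hv huv)
  refine ⟨rankOne u - rankOne v, ⟨isBoundedOp_of_bNorm_apply_le hle, ?_⟩,
    opNorm_le_of_bNorm_apply_le (Real.sqrt_nonneg _) hle, ?_⟩
  · rw [LinearMap.sub_comp, LinearMap.comp_sub, hu'.rankOne_comp_opJ, hv'.rankOne_comp_opJ]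
  · simp only [LinearMap.sub_apply, rankOne_apply_self hu, rankOne_apply_self hv, rankOne_apply,
      bInner_sub_right, bInner_smul_right, bInner_self, huv, hvu, hu, hv, one_pow,
      ← Quaternion.coe_mul, ← Quaternion.coe_sub]
    congr 1
    ring

end RankOne

section Berezin

variable {α : ℝ} {i : ImagUnit} {p q : ℍ[ℝ]}

/- A unit factor from `ℂ_i` does not change the diagonal values of operators that commute with `J`,
hence `k_q` can be rotated so that its scalar product with `k_p` becomes real. -/
theorem exists_bInner_normKernel_eq_coe (hα : -1 < α) (hp : p ∈ sliceDisc i)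
    (hq : q ∈ sliceDisc i) :
    ∃ (v : bergmanSpace α i) (c : ℝ), bNorm v = 1 ∧ IsSliceValued v ∧
      (∀ T ∈ boundedCommJ α i, bInner v (T v) = berezin T q) ∧
      bInner (normKernel α i p) v = (c : ℍ[ℝ]) ∧ c ^ 2 = (1 - pseudoHyp p q ^ 2) ^ (α + 2) := by
  obtain ⟨z, hz, rfl⟩ := exists_sliceEmb_of_mem_sliceDisc i hp
  obtain ⟨w, hw, rfl⟩ := exists_sliceEmb_of_mem_sliceDisc i hq
  obtain ⟨ζ, hζ⟩ : ∃ ζ : ℂ,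
      bInner (normKernel α i (sliceEmb i z)) (normKernel α i (sliceEmb i w)) = sliceEmb i ζ :=
    ⟨_, bInner_normKernel hα i hz hw⟩
  obtain ⟨c, hc, hcζ⟩ := RCLike.exists_norm_eq_mul_self ζ
  have hk := isSliceValued_normKernel hα i hw
  refine ⟨op (sliceEmb i c) • normKernel α i (sliceEmb i w), ‖ζ‖, ?_, hk.smul_sliceEmb c,
    fun T hT => bInner_smul_apply_smul hT.2 hk hc, ?_, ?_⟩
  · rw [bNorm_smul, bNorm_normKernel hα i hw, norm_sliceEmb, hc, mul_one]
  · rw [bInner_smul_right, hζ, ← map_mul, mul_comm, ← hcζ]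
    exact sliceEmb_ofReal i _
  · rw [← norm_sq_bInner_normKernel hα i hz hw, hζ, norm_sliceEmb]

theorem bNorm_normKernel_of_mem_sliceDisc (hα : -1 < α) (hp : p ∈ sliceDisc i) :
    bNorm (normKernel α i p) = 1 := by
  obtain ⟨z, hz, rfl⟩ := exists_sliceEmb_of_mem_sliceDisc i hp
  exact bNorm_normKernel hα i hz

theorem isSliceValued_normKernel_of_mem_sliceDisc (hα : -1 < α) (hp : p ∈ sliceDisc i) :
    IsSliceValued (normKernel α i p) := by
  obtain ⟨z, hz, rfl⟩ := exists_sliceEmb_of_mem_sliceDisc i hp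
  exact isSliceValued_normKernel hα i hz

theorem norm_berezin_sub_le (hα : -1 < α) (hp : p ∈ sliceDisc i) (hq : q ∈ sliceDisc i)
    {T : bergmanSpace α i →ₗ[(ℍ[ℝ])ᵐᵒᵖ] bergmanSpace α i} (hT : T ∈ boundedCommJ α i) :
    ‖berezin T p - berezin T q‖ ≤ 2 * opNorm T * √(1 - (1 - pseudoHyp p q ^ 2) ^ (α + 2)) := by
  obtain ⟨v, c, hv, -, hvT, hpv, hc⟩ := exists_bInner_normKernel_eq_coe hα hp hq
  have hle := norm_bInner_apply_sub_le hα hT.1 (bNorm_normKernel_of_mem_sliceDisc hα hp) hv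
  rwa [hvT T hT, hpv, Quaternion.re_coe, hc] at hle

theorem exists_norm_berezin_sub_eq (hα : -1 < α) (hp : p ∈ sliceDisc i) (hq : q ∈ sliceDisc i) :
    ∃ T ∈ boundedCommJ α i, opNorm T ≤ √(1 - (1 - pseudoHyp p q ^ 2) ^ (α + 2)) ∧
      ‖berezin T p - berezin T q‖ = 2 * |1 - (1 - pseudoHyp p q ^ 2) ^ (α + 2)| := by
  obtain ⟨v, c, hv, hv', hvT, hpv, hc⟩ := exists_bInner_normKernel_eq_coe hα hp hq
  obtain ⟨T, hT, hle, heq⟩ := exists_mem_boundedCommJ_opNorm_le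
    (bNorm_normKernel_of_mem_sliceDisc hα hp) hv (isSliceValued_normKernel_of_mem_sliceDisc hα hp)
    hv' hpv
  refine ⟨T, hT, hc ▸ hle, ?_⟩
  rw [← hvT T hT, berezin, heq, Quaternion.norm_coe, hc, norm_mul, Real.norm_ofNat,
    Real.norm_eq_abs]

end Berezin

section Artanh

theorem artanh_le_div_sqrt_one_sub_sq {r : ℝ} (hr : r ∈ Ico 0 1) :
    Real.artanh r ≤ r / √(1 - r ^ 2) := by
  rw [← Real.sinh_artanh ⟨by linarith [hr.1], hr.2⟩]
  exact Real.self_le_sinh_iff.mpr (Real.artanh_nonneg hr.1)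

/-- From `cosh x ≤ exp (x ^ 2 / 2)` and `1 / cosh (artanh r) ^ 2 = 1 - r ^ 2`. -/
theorem exp_neg_artanh_sq_le {r : ℝ} (hr : r ∈ Ico 0 1) :
    Real.exp (-Real.artanh r ^ 2) ≤ 1 - r ^ 2 := by
  have hpos : 0 < 1 - r ^ 2 := by nlinarith [hr.1, hr.2]
  have hcosh := Real.cosh_le_exp_half_sq (Real.artanh r)
  rw [Real.cosh_artanh ⟨by linarith [hr.1], hr.2⟩] at hcosh
  have hsq := pow_le_pow_left₀ (by positivity) hcosh 2
  rw [div_pow, one_pow, Real.sq_sqrt hpos.le, ← Real.exp_nat_mul, Nat.cast_ofNat,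
    mul_div_cancel₀ _ two_ne_zero] at hsq
  rw [Real.exp_neg]
  exact inv_le_of_inv_le₀ hpos (by rwa [← one_div])

theorem sqrt_one_sub_rpow_le_mul_artanh {r s : ℝ} (hr : r ∈ Ico 0 1) (hs : 0 ≤ s) :
    √(1 - (1 - r ^ 2) ^ s) ≤ √s * Real.artanh r := by
  have hexp := Real.rpow_le_rpow (Real.exp_pos _).le (exp_neg_artanh_sq_le hr) hs
  rw [← Real.exp_mul] at hexp
  have hlin := Real.add_one_le_exp (-Real.artanh r ^ 2 * s)
  rw [← Real.sqrt_sq (Real.artanh_nonneg hr.1), ← Real.sqrt_mul hs]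
  exact Real.sqrt_le_sqrt (by linarith)

theorem tendsto_one_sub_rpow_div (s : ℝ) :
    Tendsto (fun t : ℝ => (1 - (1 - t) ^ s) / t) (𝓝[>] 0) (𝓝 s) := by
  have hderiv : HasDerivAt (fun t : ℝ => 1 - (1 - t) ^ s) s 0 := by
    have h := ((hasDerivAt_id (0 : ℝ)).const_sub 1).rpow_const (p := s) (Or.inl (by simp))
    simpa using h.const_sub 1
  simpa [div_eq_inv_mul] using hderiv.tendsto_slope_zero_right

theorem sqrt_le_of_forall_sqrt_one_sub_rpow_le {C s : ℝ}
    (h : ∀ r ∈ Ioo (0 : ℝ) 1, √(1 - (1 - r ^ 2) ^ s) ≤ C * Real.artanh r) : √s ≤ C := by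
  have hhalf : (1 / 2 : ℝ) ∈ Ioo (0 : ℝ) 1 := by norm_num
  have hC : 0 ≤ C :=
    nonneg_of_mul_nonneg_left ((Real.sqrt_nonneg _).trans (h _ hhalf)) (Real.artanh_pos hhalf)
  have hbound : ∀ t ∈ Ioo (0 : ℝ) 1, √((1 - (1 - t) ^ s) / t) * √(1 - t) ≤ C := fun t ht => by
    have hr : √t ∈ Ioo (0 : ℝ) 1 :=
      ⟨Real.sqrt_pos.mpr ht.1, (Real.sqrt_lt' one_pos).mpr (by simpa using ht.2)⟩
    have hle := (h _ hr).trans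
      (mul_le_mul_of_nonneg_left (artanh_le_div_sqrt_one_sub_sq ⟨hr.1.le, hr.2⟩) hC)
    rw [Real.sq_sqrt ht.1.le, mul_div_assoc',
      le_div_iff₀ (Real.sqrt_pos.mpr (sub_pos.mpr ht.2))] at hle
    rwa [Real.sqrt_div' _ ht.1.le, div_mul_eq_mul_div, div_le_iff₀ hr.1]
  have hlim : Tendsto (fun t : ℝ => √((1 - (1 - t) ^ s) / t) * √(1 - t)) (𝓝[>] 0) (𝓝 √s) := by
    have hcont : ContinuousAt (fun t : ℝ => √(1 - t)) 0 := by fun_prop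
    simpa using (tendsto_one_sub_rpow_div s).sqrt.mul (hcont.tendsto.mono_left nhdsWithin_le_nhds)
  refine le_of_tendsto hlim ?_
  filter_upwards [Ioo_mem_nhdsGT zero_lt_one] with t ht using hbound t ht

end Artanh

section BergmanMetric

variable {α : ℝ} {i : ImagUnit} {p q : ℍ[ℝ]}

theorem bergmanMetric_eq_artanh (hp : p ∈ sliceDisc i) (hq : q ∈ sliceDisc i) :
    bergmanMetric p q = Real.artanh (pseudoHyp p q) := by
  have h := pseudoHyp_mem_Ico_of_mem_sliceDisc hp hq
  rw [bergmanMetric, Real.artanh_eq_half_log ⟨by linarith [h.1], h.2.le⟩]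

theorem norm_berezin_sub_le_bergmanMetric (hα : -1 < α) (hp : p ∈ sliceDisc i)
    (hq : q ∈ sliceDisc i) {T : bergmanSpace α i →ₗ[(ℍ[ℝ])ᵐᵒᵖ] bergmanSpace α i}
    (hT : T ∈ boundedCommJ α i) :
    ‖berezin T p - berezin T q‖ ≤ 2 * √(α + 2) * opNorm T * bergmanMetric p q := by
  rw [bergmanMetric_eq_artanh hp hq]
  calc ‖berezin T p - berezin T q‖
      ≤ 2 * opNorm T * √(1 - (1 - pseudoHyp p q ^ 2) ^ (α + 2)) := norm_berezin_sub_le hα hp hq hT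
    _ ≤ 2 * opNorm T * (√(α + 2) * Real.artanh (pseudoHyp p q)) :=
        mul_le_mul_of_nonneg_left
          (sqrt_one_sub_rpow_le_mul_artanh (pseudoHyp_mem_Ico_of_mem_sliceDisc hp hq)
            (by linarith))
          (mul_nonneg two_pos.le (opNorm_nonneg T))
    _ = 2 * √(α + 2) * opNorm T * Real.artanh (pseudoHyp p q) := by ring

theorem two_mul_sqrt_le_of_forall_norm_berezin_sub_le (hα : -1 < α) (hp : p ∈ sliceDisc i)
    (hq : q ∈ sliceDisc i) (hpq : 0 < pseudoHyp p q) {D : ℝ}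
    (h : ∀ T ∈ boundedCommJ α i, ‖berezin T p - berezin T q‖ ≤ opNorm T * D) :
    2 * √(1 - (1 - pseudoHyp p q ^ 2) ^ (α + 2)) ≤ D := by
  obtain ⟨T, hT, hnorm, heq⟩ := exists_norm_berezin_sub_eq hα hp hq
  have hρ := (pseudoHyp_mem_Ico_of_mem_sliceDisc hp hq).2
  set κ := 1 - (1 - pseudoHyp p q ^ 2) ^ (α + 2)
  have hκ : 0 < κ := sub_pos.mpr <|
    Real.rpow_lt_one (by nlinarith) (by nlinarith) (by linarith)
  have hle : 2 * κ ≤ opNorm T * D := by simpa only [heq, abs_of_pos hκ] using h T hT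
  have hD : 0 < D := pos_of_mul_pos_right (by linarith) (opNorm_nonneg T)
  have hsq : 2 * √κ * √κ ≤ D * √κ := by
    rw [mul_assoc, Real.mul_self_sqrt hκ.le, mul_comm D]
    exact hle.trans (mul_le_mul_of_nonneg_right hnorm hD.le)
  exact le_of_mul_le_mul_right hsq (Real.sqrt_pos.mpr hκ)

theorem le_of_forall_norm_berezin_sub_le_bergmanMetric (hα : -1 < α) (i : ImagUnit) {C : ℝ}
    (hC : ∀ T ∈ boundedCommJ α i, ∀ p ∈ sliceDisc i, ∀ q ∈ sliceDisc i,
      ‖berezin T p - berezin T q‖ ≤ C * opNorm T * bergmanMetric p q) :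
    2 * √(α + 2) ≤ C := by
  suffices h : √(α + 2) ≤ C / 2 by linarith
  refine sqrt_le_of_forall_sqrt_one_sub_rpow_le fun r hr => ?_
  have hp : sliceEmb i r ∈ sliceDisc i :=
    sliceEmb_mem_sliceDisc i (by simpa [abs_of_pos hr.1] using hr.2)
  have hq : sliceEmb i 0 ∈ sliceDisc i := sliceEmb_mem_sliceDisc i (by simp)
  have hρ : pseudoHyp (sliceEmb i r) (sliceEmb i 0) = r := by
    rw [pseudoHyp_sliceEmb]
    simp [abs_of_pos hr.1]
  have h := two_mul_sqrt_le_of_forall_norm_berezin_sub_le hα hp hq (hρ.symm ▸ hr.1)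
    (D := C * bergmanMetric (sliceEmb i r) (sliceEmb i 0))
    fun T hT => (hC T hT _ hp _ hq).trans_eq (by ring)
  rw [bergmanMetric_eq_artanh hp hq, hρ] at h
  linarith

end BergmanMetric

end SliceBergman

theorem mainTheorem7 (α : ℝ) (hα : -1 < α) (i : SliceBergman.ImagUnit) :
    (∀ T ∈ SliceBergman.boundedCommJ α i,
      ∀ z ∈ SliceBergman.sliceDisc i, ∀ w ∈ SliceBergman.sliceDisc i,
        ‖SliceBergman.berezin T z - SliceBergman.berezin T w‖ ≤
          2 * √(2 + α) * SliceBergman.opNorm T * SliceBergman.bergmanMetric z w) ∧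
    (∀ C : ℝ,
      (∀ T ∈ SliceBergman.boundedCommJ α i,
        ∀ z ∈ SliceBergman.sliceDisc i, ∀ w ∈ SliceBergman.sliceDisc i,
          ‖SliceBergman.berezin T z - SliceBergman.berezin T w‖ ≤
            C * SliceBergman.opNorm T * SliceBergman.bergmanMetric z w) →
      2 * √(2 + α) ≤ C) := by
  rw [add_comm 2 α]
  exact ⟨fun T hT z hz w hw => SliceBergman.norm_berezin_sub_le_bergmanMetric hα hz hw hT,
    fun C hC => SliceBergman.le_of_forall_norm_berezin_sub_le_bergmanMetric hα i hC⟩
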